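/- Let $E$ be a complex Banach space (for instance an infinite-dimensional Banach space of $\mathbb C^n$-valued fields $W=(W^1,\dots,W^n)(\mathbf r)$), let $E'$ be its continuous dual, and write $\Pi^*_j W^j:=\Pi^*(W)$ for $\Pi^*\in E'$, $W\in E$. Put $\mathcal E_{\mathbb C}=T^*E\times\mathbb R=E\times E'\times\mathbb R\ni(W,\Pi^*,t)$; tangent vectors and forms are taken on the complex tangent space $E\times E'\times\mathbb C$ (holomorphic in $(W,\Pi^*)$, complex multiples of $\partial_t$). Fix a Borel reference measure on $E$; $\mathbb P$ is the space of smooth densities $P[W]\ge 0$ of probability measures with respect to it, assumed to contain a positive one; $J^\infty(E,\mathbb P)\to E$ is the bundle of infinite jets $(W,(P_{\mu_1\cdots\mu_k})_{k})$ of elements of $\mathbb P$; and, for coefficients $B$, the conjugate field of a jet is the sum over all orders $k\ge1$, $\Pi^*_j=\sum_k B_j^{\mu_1\cdots\mu_k}P_{\mu_1\cdots\mu_k}$, when it converges in $E'$. Let $\mathcal H=\mathcal H[W,\Pi^*,t]:\mathcal E_{\mathbb C}\to\mathbb C$ be smooth and holomorphic in $(W,\Pi^*)$, such that $\partial\mathcal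 H/\partial\Pi^*$ takes values in $E\subset E''$ (automatic if $E$ is reflexive). Let $$\Theta_{\mathbb C}=\mathcal H\,dt-\Pi^*_j\,dW^j,\qquad \varepsilon_{\mathbb C}=\Pi^*_j\,\frac{\partial\mathcal H}{\partial\Pi^*_j}-\mathcal H,\qquad \{F,G\}=\frac{\partial F}{\partial W^j}\frac{\partial G}{\partial\Pi^*_j}-\frac{\partial F}{\partial\Pi^*_j}\frac{\partial G}{\partial W^j},$$ and assume $d\varepsilon_{\mathbb C}=0$ and $\varepsilon_{\mathbb C}\neq0$. Then: (1) For every choice of $B$, the form $\Theta_{\mathbb C}$ at the point given by a jet with conjugate field $\Pi^*$ is $\mathcal H\,dt-\sum_k B_j^{\mu_1\cdots\mu_k}P_{\mu_1\cdots\mu_k}\,dW^j$, and for suitable $B$ every $(W,\Pi^*)\in T^*E$ comes from a jet. $\Theta_{\mathbb C}$ is a contact form on $\mathcal E_{\mathbb C}$: it vanishes nowhere and $d\Theta_{\mathbb C}|_{\ker\Theta_{\mathbb C}}$ is (weakly) nondegenerate. The rank of $d\Theta_{\mathbb C}|_{\ker\Theta_{\mathbb C}}$ is $\dim(E\times E')$,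 and with $n=\frac12\operatorname{rank}(d\Theta_{\mathbb C}|_{\ker\Theta_{\mathbb C}})\in\mathbb N\cup\{\infty\}$ the form $\Theta_{\mathbb C}\wedge(d\Theta_{\mathbb C})^{\wedge k}$ vanishes nowhere for every finite $k\le n$; if $n<\infty$, the form with $k=n$ has top degree $2n+1$, so it is a volume form. (2) There is a unique vector field $X$ with $\iota_X\Theta_{\mathbb C}=-\varepsilon_{\mathbb C}$ and $\iota_X d\Theta_{\mathbb C}=0$. It is smooth (holomorphic in $(W,\Pi^*)$), equals $(\dot W,\dot\Pi^*,\dot t)=(\partial\mathcal H/\partial\Pi^*,-\partial\mathcal H/\partial W,1)$, so that $\varepsilon_{\mathbb C}=\Pi^*_j\dot W^j-\mathcal H$, and satisfies $L_X\Theta_{\mathbb C}=0$; every local flow of $X$ of class $C^2$ preserves $\Theta_{\mathbb C}$. (3) For $C^1$ paths $(W(t),\Pi^*(t))$, $a\le t\le b$, $a<b$, let $\mathcal S=-\int\Theta_{\mathbb C}=\int_a^b(\Pi^*_j\dot W^j-\mathcal H)\,dt$. A path is an extremal of $\mathcal S$ for variations that fix the endpoints of $W$ if and only if $(W(t),\Pi^*(t),t)$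 is an integral curve of $X$, and then $\mathcal S=\int_a^b\varepsilon_{\mathbb C}\,dt$. Along extremals $\partial_tW=\{W,\mathcal H\}$ and $\partial_t\Pi^*=\{\Pi^*,\mathcal H\}$ (for $W$ and $\Pi^*$ tested with all elements of $E'$ and $E$), and $\frac{dF}{dt}=\{F,\mathcal H\}+\frac{\partial F}{\partial t}$ for every smooth $F[W,\Pi^*,t]$ that is holomorphic in $(W,\Pi^*)$; moreover $\frac{\partial\varepsilon_{\mathbb C}}{\partial t}=-\{\varepsilon_{\mathbb C},\mathcal H\}$ on $\mathcal E_{\mathbb C}$. Finally, for all $W_0\in E$, $t_0\in\mathbb R$ and every functional $\mathcal S_0$ that is analytic at $W_0$ there is $r>0$ such that for all $\|w-W_0\|<r$ and $|t-t_0|<r$ there is an integral curve of $X$ between the times $t_0$ and $t$ that starts with $\Pi^*(t_0)=\partial\mathcal S_0/\partial W$ at $W(t_0)$ and has $W(t)=w$, and the action $\mathcal S[w,t]=\mathcal S_0[W(t_0)]+\int_{t_0}^t\varepsilon_{\mathbb C}\,ds$ of such curves depends on $(w,t)$ only, is complex differentiable in $w$ and differentiable in $t$, and satisfies $\mathcal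 S[\cdot,t_0]=\mathcal S_0$ near $W_0$, $$\frac{\partial\mathcal S}{\partial W}=\Pi^*(t),\qquad \frac{\partial\mathcal S}{\partial t}+\mathcal H\Big[W,\frac{\partial\mathcal S}{\partial W},t\Big]=0 .$$ -/

import Mathlib

open Set Filter Topology MeasureTheory
open scoped ContDiff

noncomputable section

namespace LeastConstraint

universe u

/-! ### Phase space, complexified tangent space, differentials

`E` is a complex Banach space of fields `W`. The conjugate fields `Π` are the continuous
`ℂ`-linear functionals on `E`, and `Π W` is the (summed and integrated) pairing `Π_j W^j`. -/

/-- The extended phase space `T*E × ℝ`, with points `(W, Π, t)`. -/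
abbrev Phase (E : Type u) [NormedAddCommGroup E] [NormedSpace ℂ E] : Type u :=
  E × StrongDual ℂ E × ℝ

/-- The complex tangent space of `T*E × ℝ` at any of its points: the holomorphic tangent space
`E × E'` of `T*E` together with the complex multiples of `∂/∂t`. The vectors whose last entry is
real are the tangent vectors of `T*E × ℝ`. -/
abbrev Tangent (E : Type u) [NormedAddCommGroup E] [NormedSpace ℂ E] : Type u :=
  E × StrongDual ℂ E × ℂ

variable {E : Type u} [NormedAddCommGroup E] [NormedSpace ℂ E]
variable {G : Type*} [NormedAddCommGroup G] [NormedSpace ℂ G]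

/-- The inclusion of `E × E' × ℝ` (points, or tangent vectors) in `E × E' × ℂ`. -/
def incl (p : Phase E) : Tangent E := (p.1, p.2.1, (p.2.2 : ℂ))

/-- Smooth in `(W, Π, t)` and holomorphic in `(W, Π)`. -/
structure IsSmoothHol (f : Phase E → G) : Prop where
  smooth : ContDiff ℝ ∞ f
  hol : ∀ t : ℝ, Differentiable ℂ (fun q : E × StrongDual ℂ E => f (q.1, q.2, t))

/-- The functional derivative `∂f/∂W`. -/
def dW (f : Phase E → G) (p : Phase E) : E →L[ℂ] G :=
  fderiv ℂ (fun w : E => f (w, p.2.1, p.2.2)) p.1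

/-- The functional derivative `∂f/∂Π`. -/
def dPi (f : Phase E → G) (p : Phase E) : StrongDual ℂ E →L[ℂ] G :=
  fderiv ℂ (fun ξ : StrongDual ℂ E => f (p.1, ξ, p.2.2)) p.2.1

/-- The partial derivative `∂f/∂t`. -/
def dTime (f : Phase E → G) (p : Phase E) : G :=
  deriv (fun s : ℝ => f (p.1, p.2.1, s)) p.2.2

/-- The differential `df = (∂f/∂W) dW + (∂f/∂Π) dΠ + (∂f/∂t) dt`. -/
def diff (f : Phase E → G) (p : Phase E) : Tangent E →L[ℂ] G :=
  (dW f p).coprod ((dPi f p).coprod (ContinuousLinearMap.toSpanSingleton ℂ (dTime f p)))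

/-- The exterior derivative of a one-form, `dα(X, Y) = (D_X α)(Y) - (D_Y α)(X)`. -/
def extD (α : Phase E → Tangent E →L[ℂ] ℂ) (p : Phase E) :
    Tangent E →L[ℂ] Tangent E →L[ℂ] ℂ :=
  diff α p - (diff α p).flip

/-- The Lie derivative of a one-form, `(L_X α)(Y) = (D_X α)(Y) + α(D_Y X)`. -/
def lieD (X : Phase E → Tangent E) (α : Phase E → Tangent E →L[ℂ] ℂ) (p : Phase E)
    (Y : Tangent E) : ℂ :=
  diff α p (X p) Y + α p (diff X p Y)

/-- The bracket `{F, G} = (∂F/∂W) (∂G/∂Π) - (∂F/∂Π) (∂G/∂W)`; here `∂F/∂W` lies in `E'`, and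
`∂G/∂Π` is a functional on `E'`. -/
def bracket (f g : Phase E → ℂ) (p : Phase E) : ℂ :=
  dPi g p (dW f p) - dPi f p (dW g p)

/-! ### The contact form and the constraint functional -/

/-- The one-form `Θ = H dt - Π_j dW^j`. -/
def contactForm (H : Phase E → ℂ) (p : Phase E) : Tangent E →L[ℂ] ℂ :=
  H p • (ContinuousLinearMap.snd ℂ (StrongDual ℂ E) ℂ ∘L
      ContinuousLinearMap.snd ℂ E (StrongDual ℂ E × ℂ)) -
    p.2.1 ∘L ContinuousLinearMap.fst ℂ E (StrongDual ℂ E × ℂ)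

/-- The constraint functional `ε = Π_j (∂H/∂Π_j) - H`. -/
def constraint (H : Phase E → ℂ) (p : Phase E) : ℂ :=
  dPi H p p.2.1 - H p

/-- The kernel of a one-form at a point. -/
def hyperplane (α : Phase E → Tangent E →L[ℂ] ℂ) (p : Phase E) : Submodule ℂ (Tangent E) :=
  LinearMap.ker (α p).toLinearMap

/-- The restriction of `dα` to `ker α`. -/
def transverseForm (α : Phase E → Tangent E →L[ℂ] ℂ) (p : Phase E) :
    hyperplane α p →ₗ[ℂ] hyperplane α p →ₗ[ℂ] ℂ :=
  (extD α p).toLinearMap₁₂.domRestrict₁₂ (hyperplane α p) (hyperplane α p)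

/-- The values of `α ∧ (dα)^{∧k}`, that is, the full alternation of `α ⊗ dα ⊗ ⋯ ⊗ dα` with the
normalization of the wedge product. -/
def contactVolume (α : Phase E → Tangent E →L[ℂ] ℂ) (k : ℕ) (p : Phase E)
    (v : Fin (2 * k + 1) → Tangent E) : ℂ :=
  (1 / 2 ^ k : ℂ) * ∑ σ : Equiv.Perm (Fin (2 * k + 1)), ((Equiv.Perm.sign σ : ℤ) : ℂ) *
    (α p (v (σ 0)) * ∏ i : Fin k,
      extD α p (v (σ ⟨2 * i + 1, by omega⟩)) (v (σ ⟨2 * i + 2, by omega⟩)))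

/-- A contact form: it vanishes nowhere and `dα` is (weakly) nondegenerate on `ker α`. -/
def IsContactForm (α : Phase E → Tangent E →L[ℂ] ℂ) : Prop :=
  ∀ p, α p ≠ 0 ∧ ∀ X : hyperplane α p, (∀ Y, transverseForm α p X Y = 0) → X = 0

/-- `ι_X Θ = -ε` and `ι_X dΘ = 0`. -/
def IsCharacteristic (H : Phase E → ℂ) (X : Phase E → Tangent E) : Prop :=
  ∀ p, contactForm H p (X p) = -constraint H p ∧ ∀ Y, extD (contactForm H) p (X p) Y = 0

/-! ### Flow lines, action, extremals -/

/-- `t ↦ (W(t), Π(t), t)` is an integral curve of `X` at the times in `I`. -/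
def IsFlowLine (X : Phase E → Tangent E) (W : ℝ → E) (Pi : ℝ → StrongDual ℂ E) (I : Set ℝ) :
    Prop :=
  ∀ t ∈ I, HasDerivAt (fun s => incl (W s, Pi s, s)) (X (W t, Pi t, t)) t

/-- `φ` is a local flow of `X` on `U`, for the times in `(-δ, δ)`. -/
structure IsLocalFlow (X : Phase E → Tangent E) (U : Set (Phase E)) (δ : ℝ)
    (φ : ℝ → Phase E → Phase E) : Prop where
  isOpen : IsOpen U
  regular : ContDiffOn ℝ 2 (fun q : ℝ × Phase E => φ q.1 q.2) (Ioo (-δ) δ ×ˢ U)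
  zero : ∀ p ∈ U, φ 0 p = p
  deriv : ∀ s ∈ Ioo (-δ) δ, ∀ p ∈ U, HasDerivAt (fun r => incl (φ r p)) (X (φ s p)) s

/-- The action `-∫ Θ` along `t ↦ (W(t), Π(t), t)`, `a ≤ t ≤ b`. -/
def action (H : Phase E → ℂ) (a b : ℝ) (W : ℝ → E) (Pi : ℝ → StrongDual ℂ E) : ℂ :=
  -∫ t in a..b, contactForm H (W t, Pi t, t) (deriv W t, deriv Pi t, 1)

/-- The first variation of the action vanishes for all variations of `(W, Π)` that keep the
endpoints of `W` fixed. -/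
def IsExtremal (H : Phase E → ℂ) (a b : ℝ) (W : ℝ → E) (Pi : ℝ → StrongDual ℂ E) : Prop :=
  ∀ (w : ℝ → E) (ξ : ℝ → StrongDual ℂ E), ContDiff ℝ 1 w → ContDiff ℝ 1 ξ →
    w a = 0 → w b = 0 →
    HasDerivAt (fun s : ℝ => action H a b (fun t => W t + s • w t) (fun t => Pi t + s • ξ t)) 0 0

/-- `(W, Π)` is a flow line between the times `t₀` and `t` that starts on the graph of `∂S₀/∂W`
and arrives at the field `w` at time `t`. -/
structure IsRay (X : Phase E → Tangent E) (S₀ : E → ℂ) (t₀ : ℝ) (w : E) (t : ℝ)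
    (W : ℝ → E) (Pi : ℝ → StrongDual ℂ E) : Prop where
  flow : IsFlowLine X W Pi (uIcc t₀ t)
  start : Pi t₀ = fderiv ℂ S₀ (W t₀)
  arrive : W t = w

/-! ### The stochastic jet bundle -/

section Jets

variable [MeasurableSpace E]

/-- The space `ℙ`: probability measures on `E` given by a smooth density functional `P[W]` with
respect to a reference volume. -/
structure ProbabilityFunctional (vol : Measure E) where
  density : E → ℝ
  smooth : ContDiff ℝ ∞ density
  nonneg : ∀ W, 0 ≤ density W
  isProb : IsProbabilityMeasure (vol.withDensity fun W => ENNReal.ofReal (density W))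

/-- The bundle `J^∞(E, ℙ)`: a point `W` of `E` with the derivatives of all orders at `W` of an
element `P` of `ℙ`; `coeff k` collects the jet coordinates `P_{μ₁⋯μ_k}`. -/
structure StochasticJet (vol : Measure E) where
  base : E
  coeff : (k : ℕ) → E [×k]→L[ℝ] ℝ
  isJet : ∃ P : ProbabilityFunctional vol, ∀ k, coeff k = iteratedFDeriv ℝ k P.density base

/-- Coefficients `B_j^{μ₁⋯μ_k}`, one family for every order `k + 1 = 1, 2, …`: at every point of
`E`, linear maps from the jet coordinates to `E'`. -/
abbrev JetCoefficients (E : Type u) [NormedAddCommGroup E] [NormedSpace ℂ E] : Type u :=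
  (k : ℕ) → E → (E [×(k + 1)]→L[ℝ] ℝ) →L[ℝ] StrongDual ℂ E

/-- `Π_j = B_j^{μ₁⋯μ_∞} P_{μ₁⋯μ_∞}`, as a convergent sum over all orders. -/
def IsConjugateField {vol : Measure E} (B : JetCoefficients E) (j : StochasticJet vol)
    (Pi : StrongDual ℂ E) : Prop :=
  HasSum (fun k => B k j.base (j.coeff (k + 1))) Pi

end Jets

end LeastConstraint

end

open LeastConstraint

/-! Write `∂H/∂Π = V`, a field on the extended phase space.

The kernel of `dΘ` is spanned by `(V, -∂H/∂W, 1)` (`eq_smul_charVec`), on which `Θ` takes the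
value `-ε` (`contactForm_charVec`). Since `ε ≠ 0`, this line is transverse to `ker Θ`, and the
projection along it identifies `ker Θ` with `E × E'` and `dΘ` with the canonical symplectic form.
This gives nondegeneracy and the rank; a vector on the line followed by `k` canonical pairs makes
all nonzero terms of the alternation in `Θ ∧ (dΘ)^k` equal (`alternation_ne_zero`). The
characteristic field `X` is the section of the line with last entry `1`. It is smooth and
holomorphic although only its image in the bidual is given as a derivative, because `E` is closed
in the bidual (`contDiff_of_comp_isometry`). Cartan's formula and `dε = 0` give `L_X Θ = 0`, hence
the invariance of `Θ` under `C²` flows.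

Every covector comes from a jet: the first derivative at a point of a positive density, reweighted
by a bounded function of mean one, can be prescribed (`exists_fderiv_density`).

The extremals of the action are the flow lines by the first variation and the fundamental lemma of
the calculus of variations.

The Hamilton-Jacobi equation uses the full strength of `dε = 0`. The constraint is then a constant
`ε`, and Euler's relation `Π ∂H/∂Π - H = ε` makes `H + ε` homogeneous of degree one in `Π`; a
function that is homogeneous of degree one and differentiable at `Π = 0` is linear, so that
`H[W, Π, t] = Π(v(W, t)) - ε` for a time dependent vector field `v` on `E` (`hamiltonian_eq`). Flow
lines of `X` are therefore solutions of `dW/dt = v(W, t)` together with solutions of the adjoint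
linear equation for `Π`, and the action of a ray is `ε (t - t₀)`. With `Φ(w, t)` the point at time
`t₀` of the solution that passes through `w` at time `t` (`footPoint`), the action functional is
`S[w, t] = S₀[Φ(w, t)] + ε (t - t₀)`. Its derivatives come from the adjoint equation: `Π` paired
with the difference of two neighbouring solutions is constant in time up to an error of second
order (`IsFlowBox.norm_pairing_sub_le`). This avoids the differentiable dependence of solutions on
initial values. -/

namespace LeastConstraint

universe u

/-! ### Differentials of smooth holomorphic functions -/

section Isometry

section

variable {𝕜 D F G : Type*} [RCLike 𝕜] [NormedAddCommGroup D] [NormedSpace 𝕜 D]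
  [NormedAddCommGroup F] [NormedSpace 𝕜 F] [CompleteSpace F]
  [NormedAddCommGroup G] [NormedSpace 𝕜 G]

/-- A map into a Banach space is differentiable as soon as it is so after composition with a linear
isometry: the range of the isometry is closed, so it contains all directional derivatives. -/
theorem exists_hasFDerivAt_of_comp_isometry (J : F →ₗᵢ[𝕜] G) {f : D → F} {x : D} {L : D →L[𝕜] G}
    (h : HasFDerivAt (fun y => J (f y)) L x) :
    ∃ L' : D →L[𝕜] F, HasFDerivAt f L' x ∧ J.toContinuousLinearMap ∘L L' = L := by
  have hcl : IsClosed (LinearMap.range J.toLinearMap : Set G) := by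
    have := J.isometry.isClosedEmbedding.isClosed_range
    simpa [LinearMap.coe_range] using this
  have hmem : ∀ y, L y ∈ LinearMap.range J.toLinearMap := by
    intro y
    refine hcl.mem_of_tendsto (h.hasLineDerivAt y).tendsto_slope_zero
      (Eventually.of_forall fun t => ?_)
    exact ⟨t⁻¹ • (f (x + t • y) - f x), by simp⟩
  let e := J.equivRange
  let L' : D →L[𝕜] F := (e.symm.toContinuousLinearEquiv : _ →L[𝕜] F) ∘L
    L.codRestrict (LinearMap.range J.toLinearMap) hmem
  have hJL : ∀ y, J (L' y) = L y := by
    intro y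
    have : e (e.symm ⟨L y, hmem y⟩) = ⟨L y, hmem y⟩ := e.apply_symm_apply _
    exact congrArg Subtype.val this
  refine ⟨L', ?_, by ext y; exact hJL y⟩
  rw [hasFDerivAt_iff_isLittleO] at h ⊢
  refine h.norm_left.congr_left (fun y => ?_) |>.of_norm_left
  rw [← J.norm_map (f y - f x - L' (y - x)), map_sub J _ (L' (y - x)), map_sub J, hJL]

end

variable {D F G : Type u} [NormedAddCommGroup D] [NormedSpace ℝ D]
  [NormedAddCommGroup F] [NormedSpace ℝ F] [CompleteSpace F]
  [NormedAddCommGroup G] [NormedSpace ℝ G]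

/-- Smoothness into a Banach space can be tested after composition with a linear isometry. -/
theorem contDiff_of_comp_isometry (J : F →ₗᵢ[ℝ] G) {f : D → F}
    (h : ContDiff ℝ ∞ (fun y => J (f y))) : ContDiff ℝ ∞ f := by
  rw [contDiff_infty] at h ⊢
  intro n
  specialize h n
  induction n generalizing F G with
  | zero =>
    rw [Nat.cast_zero, contDiff_zero] at h ⊢
    exact J.isometry.isEmbedding.continuous_iff.2 h
  | succ n ih =>
    have hd : ∀ x, DifferentiableAt ℝ f x ∧
        J.toContinuousLinearMap ∘L fderiv ℝ f x = fderiv ℝ (fun y => J (f y)) x := by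
      intro x
      obtain ⟨L', h1, h2⟩ := exists_hasFDerivAt_of_comp_isometry J
        ((h.differentiable (by simp)) x).hasFDerivAt
      exact ⟨h1.differentiableAt, by rw [h1.fderiv, h2]⟩
    push_cast at h ⊢
    rw [contDiff_succ_iff_fderiv] at h ⊢
    refine ⟨fun x => (hd x).1, by simp, ?_⟩
    let P : (D →L[ℝ] F) →ₗᵢ[ℝ] (D →L[ℝ] G) := J.postcomp
    refine ih P ?_
    convert h.2.2 using 2 with x
    exact (hd x).2

end Isometry

section Complex

variable {Q : Type u} [NormedAddCommGroup Q] [NormedSpace ℂ Q] {g : Q → ℂ}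

theorem restrictScalars_fderiv (hg : Differentiable ℂ g) (q : Q) :
    (fderiv ℂ g q).restrictScalars ℝ = fderiv ℝ g q :=
  (((hg q).hasFDerivAt.restrictScalars ℝ).fderiv).symm

theorem contDiff_of_restrictScalars {D : Type u} [NormedAddCommGroup D] [NormedSpace ℝ D]
    {f : D → Q →L[ℂ] ℂ} (h : ContDiff ℝ ∞ (fun x => (f x).restrictScalars ℝ)) :
    ContDiff ℝ ∞ f :=
  contDiff_of_comp_isometry (ContinuousLinearMap.restrictScalarsIsometry ℂ Q ℂ ℝ ℝ) h

theorem contDiff_fderiv_complex (hs : ContDiff ℝ ∞ g) (hg : Differentiable ℂ g) :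
    ContDiff ℝ ∞ (fderiv ℂ g) := by
  refine contDiff_of_restrictScalars ?_
  rw [funext fun q => restrictScalars_fderiv hg q]
  exact hs.fderiv_right (by simp)

/-- The derivative of a smooth holomorphic function on a complex normed space is holomorphic: its
real derivative is the second derivative, which is symmetric, so that complex linearity in one
argument gives complex linearity in the other. -/
theorem differentiable_fderiv_complex (hs : ContDiff ℝ ∞ g) (hg : Differentiable ℂ g) :
    Differentiable ℂ (fderiv ℂ g) := by
  intro q
  have hd : DifferentiableAt ℝ (fderiv ℂ g) q :=
    (contDiff_fderiv_complex hs hg).differentiable (by simp) q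
  have key : ∀ h k, fderiv ℝ (fderiv ℂ g) q h k = fderiv ℝ (fderiv ℝ g) q h k := by
    intro h k
    have e : fderiv ℝ g = fun y => ContinuousLinearMap.restrictScalarsL ℂ Q ℂ ℝ ℝ
        (fderiv ℂ g y) := funext fun q => (restrictScalars_fderiv hg q).symm
    have h2 := ((ContinuousLinearMap.restrictScalarsL ℂ Q ℂ ℝ ℝ).hasFDerivAt.comp q
      hd.hasFDerivAt).fderiv
    rw [e]
    exact (congrArg (fun A => A h k) h2).symm
  have hsym : ∀ h k, fderiv ℝ (fderiv ℂ g) q h k = fderiv ℝ (fderiv ℂ g) q k h := by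
    intro h k
    rw [key, key]
    exact (hs.contDiffAt.isSymmSndFDerivAt (by simpa using ENat.LEInfty.out)) h k
  let A : Q →L[ℂ] (Q →L[ℂ] ℂ) :=
    { toFun := fderiv ℝ (fderiv ℂ g) q
      map_add' := map_add _
      map_smul' := fun c h => by
        ext k
        rw [hsym, map_smul, hsym k h]
        rfl
      cont := (fderiv ℝ (fderiv ℂ g) q).continuous }
  exact (hasFDerivAt_of_restrictScalars ℝ (f' := A) hd.hasFDerivAt rfl).differentiableAt

end Complex

section Phase

variable {E : Type u} [NormedAddCommGroup E] [NormedSpace ℂ E]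
variable {G : Type*} [NormedAddCommGroup G] [NormedSpace ℂ G]

/-- The inclusion `incl` as a continuous real linear map. -/
noncomputable def inclL : Phase E →L[ℝ] Tangent E :=
  (ContinuousLinearMap.id ℝ E).prodMap
    ((ContinuousLinearMap.id ℝ (StrongDual ℂ E)).prodMap Complex.ofRealCLM)

theorem inclL_apply (p : Phase E) : inclL p = incl p := rfl

theorem diff_apply (f : Phase E → G) (p : Phase E) (Y : Tangent E) :
    diff f p Y = dW f p Y.1 + (dPi f p Y.2.1 + Y.2.2 • dTime f p) := rfl

theorem partial_eq_zero_of_diff_eq_zero {f : Phase E → G} {p : Phase E} (h : diff f p = 0) :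
    dW f p = 0 ∧ dPi f p = 0 ∧ dTime f p = 0 := by
  refine ⟨?_, ?_, ?_⟩
  · ext a
    have := congrArg (fun A => A (a, 0, 0)) h
    simpa [diff_apply] using this
  · ext b
    have := congrArg (fun A => A (0, b, 0)) h
    simpa [diff_apply] using this
  · have := congrArg (fun A => A (0, 0, 1)) h
    simpa [diff_apply] using this

namespace IsSmoothHol

variable {f : Phase E → G}

theorem hasFDerivAt_fst (hf : IsSmoothHol f) (p : Phase E) :
    HasFDerivAt (fun w : E => f (w, p.2.1, p.2.2)) (dW f p) p.1 := by
  have h : DifferentiableAt ℂ (fun w : E => f (w, p.2.1, p.2.2)) p.1 :=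
    (hf.hol p.2.2 (p.1, p.2.1)).comp p.1
      (f := fun w : E => (w, p.2.1)) (by fun_prop)
  exact h.hasFDerivAt

theorem hasFDerivAt_snd (hf : IsSmoothHol f) (p : Phase E) :
    HasFDerivAt (fun ξ : StrongDual ℂ E => f (p.1, ξ, p.2.2)) (dPi f p) p.2.1 := by
  have h : DifferentiableAt ℂ (fun ξ : StrongDual ℂ E => f (p.1, ξ, p.2.2)) p.2.1 :=
    (hf.hol p.2.2 (p.1, p.2.1)).comp p.2.1
      (f := fun ξ : StrongDual ℂ E => (p.1, ξ)) (by fun_prop)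
  exact h.hasFDerivAt

/-- The real derivative of a smooth and holomorphic function is its differential. -/
theorem hasFDerivAt (hf : IsSmoothHol f) (p : Phase E) :
    HasFDerivAt f (((diff f p).restrictScalars ℝ) ∘L inclL) p := by
  have h := (hf.smooth.differentiable (by simp) p).hasFDerivAt
  suffices e : ((diff f p).restrictScalars ℝ) ∘L inclL = fderiv ℝ f p by rwa [e]
  have h1 : ∀ a, fderiv ℝ f p (a, 0, 0) = dW f p a := fun a => by
    have e1 : HasFDerivAt (fun w : E => ((w, p.2.1, p.2.2) : Phase E))
      (ContinuousLinearMap.inl ℝ E (StrongDual ℂ E × ℝ)) p.1 := hasFDerivAt_prodMk_left _ _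
    have := (h.comp p.1 e1).unique ((hf.hasFDerivAt_fst p).restrictScalars ℝ)
    exact congrArg (fun A : E →L[ℝ] G => A a) this
  have h2 : ∀ b, fderiv ℝ f p (0, b, 0) = dPi f p b := fun b => by
    have e1 : HasFDerivAt (fun ξ : StrongDual ℂ E => ((p.1, ξ, p.2.2) : Phase E))
      ((ContinuousLinearMap.inr ℝ E (StrongDual ℂ E × ℝ)) ∘L
        (ContinuousLinearMap.inl ℝ (StrongDual ℂ E) ℝ)) p.2.1 :=
      (hasFDerivAt_prodMk_right p.1 (p.2.1, p.2.2)).comp p.2.1 (hasFDerivAt_prodMk_left p.2.1 p.2.2)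
    have := (h.comp p.2.1 e1).unique ((hf.hasFDerivAt_snd p).restrictScalars ℝ)
    exact congrArg (fun A : StrongDual ℂ E →L[ℝ] G => A b) this
  have h3 : fderiv ℝ f p (0, 0, 1) = dTime f p := by
    have e1 : HasFDerivAt (fun s : ℝ => ((p.1, p.2.1, s) : Phase E))
      ((ContinuousLinearMap.inr ℝ E (StrongDual ℂ E × ℝ)) ∘L
        (ContinuousLinearMap.inr ℝ (StrongDual ℂ E) ℝ)) p.2.2 :=
      (hasFDerivAt_prodMk_right p.1 (p.2.1, p.2.2)).comp p.2.2 (hasFDerivAt_prodMk_right p.2.1 p.2.2)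
    have := (h.comp p.2.2 e1).hasDerivAt.deriv
    simpa [dTime, Function.comp_def] using this.symm
  refine ContinuousLinearMap.ext fun Y => ?_
  have hY : Y = (Y.1, 0, 0) + (0, Y.2.1, 0) + Y.2.2 • ((0, 0, 1) : Phase E) := by
    ext <;> simp
  conv_rhs => rw [hY, map_add, map_add, map_smul, h1, h2, h3]
  simp [inclL_apply, incl, diff_apply, add_assoc]

theorem fderiv_apply (hf : IsSmoothHol f) (p Y : Phase E) :
    fderiv ℝ f p Y = diff f p (incl Y) := by
  rw [(hf.hasFDerivAt p).fderiv]; rfl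

theorem dW_apply (hf : IsSmoothHol f) (p : Phase E) (a : E) :
    dW f p a = fderiv ℝ f p (a, 0, 0) := by
  simp [hf.fderiv_apply, incl, diff_apply]

theorem dPi_apply (hf : IsSmoothHol f) (p : Phase E) (b : StrongDual ℂ E) :
    dPi f p b = fderiv ℝ f p (0, b, 0) := by
  simp [hf.fderiv_apply, incl, diff_apply]

theorem hasDerivAt_time (hf : IsSmoothHol f) (p : Phase E) :
    HasDerivAt (fun s : ℝ => f (p.1, p.2.1, s)) (dTime f p) p.2.2 := by
  have : DifferentiableAt ℝ (fun s : ℝ => f (p.1, p.2.1, s)) p.2.2 :=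
    (hf.smooth.differentiable (by simp)).comp
      (f := fun s : ℝ => ((p.1, p.2.1, s) : Phase E)) (by fun_prop) p.2.2
  exact this.hasDerivAt

theorem contDiff_slice (hf : IsSmoothHol f) (t : ℝ) :
    ContDiff ℝ ∞ (fun q : E × StrongDual ℂ E => f (q.1, q.2, t)) :=
  hf.smooth.comp (g := f) (f := fun q : E × StrongDual ℂ E => ((q.1, q.2, t) : Phase E))
    (by fun_prop)

/-- The functional derivative `∂f/∂W` of a smooth holomorphic function is smooth and holomorphic. -/
theorem dW {f : Phase E → ℂ} (hf : IsSmoothHol f) : IsSmoothHol (dW f) where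
  smooth := by
    refine contDiff_of_restrictScalars ?_
    have : (fun p => (LeastConstraint.dW f p).restrictScalars ℝ) =
        fun p => fderiv ℝ f p ∘L ContinuousLinearMap.inl ℝ E (StrongDual ℂ E × ℝ) := by
      funext p; ext a; exact hf.dW_apply p a
    rw [this]
    exact (hf.smooth.fderiv_right (m := ∞) (by simp)).clm_comp contDiff_const
  hol := fun t => by
    have : (fun q : E × StrongDual ℂ E => LeastConstraint.dW f (q.1, q.2, t)) = fun q =>
        fderiv ℂ (fun q : E × StrongDual ℂ E => f (q.1, q.2, t)) q ∘L
          ContinuousLinearMap.inl ℂ E (StrongDual ℂ E) := by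
      funext q
      exact (HasFDerivAt.comp (f := fun w => (w, q.2)) q.1 ((hf.hol t q).hasFDerivAt)
        (hasFDerivAt_prodMk_left q.1 q.2)).fderiv
    rw [this]
    exact (differentiable_fderiv_complex (hf.contDiff_slice t) (hf.hol t)).clm_comp
      (differentiable_const _)

/-- The functional derivative `∂f/∂Π` of a smooth holomorphic function is smooth and holomorphic. -/
theorem dPi {f : Phase E → ℂ} (hf : IsSmoothHol f) : IsSmoothHol (dPi f) where
  smooth := by
    refine contDiff_of_restrictScalars ?_
    have : (fun p => (LeastConstraint.dPi f p).restrictScalars ℝ) =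
        fun p => fderiv ℝ f p ∘L (ContinuousLinearMap.inr ℝ E (StrongDual ℂ E × ℝ) ∘L
          ContinuousLinearMap.inl ℝ (StrongDual ℂ E) ℝ) := by
      funext p; ext a; exact hf.dPi_apply p a
    rw [this]
    exact (hf.smooth.fderiv_right (m := ∞) (by simp)).clm_comp contDiff_const
  hol := fun t => by
    have : (fun q : E × StrongDual ℂ E => LeastConstraint.dPi f (q.1, q.2, t)) = fun q =>
        fderiv ℂ (fun q : E × StrongDual ℂ E => f (q.1, q.2, t)) q ∘L
          ContinuousLinearMap.inr ℂ E (StrongDual ℂ E) := by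
      funext q
      exact (HasFDerivAt.comp (f := fun ξ => (q.1, ξ)) q.2 ((hf.hol t q).hasFDerivAt)
        (hasFDerivAt_prodMk_right q.1 q.2)).fderiv
    rw [this]
    exact (differentiable_fderiv_complex (hf.contDiff_slice t) (hf.hol t)).clm_comp
      (differentiable_const _)

end IsSmoothHol

end Phase

/-! ### The powers of the differential of the contact form -/

section Alternation

open Equiv

/-- A permutation of `k` pairs and a point that fixes the point and maps pairs to pairs has as its
sign the number of the pairs whose order it reverses. -/
theorem sign_of_map_pairs {k : ℕ} {τ : Perm (Option (Fin k × Bool))} {π : Fin k → Fin k}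
    {s : Fin k → Bool} (h0 : τ none = none)
    (h1 : ∀ i b, τ (some (i, b)) = some (π i, xor (s i) b)) :
    (Perm.sign τ : ℤ) = ∏ i, (if s i then -1 else 1) := by
  have hπ : Function.Injective π := by
    intro i j hij
    have : τ (some (i, s i)) = τ (some (j, s j)) := by
      rw [h1, h1, hij]; simp
    simpa using congrArg (Option.map Prod.fst) (τ.injective this)
  let ρ : Perm (Fin k) := Equiv.ofBijective π (Finite.injective_iff_bijective.1 hπ)
  let φ : Fin k → Perm Bool := fun i => if s i then Equiv.swap false true else 1
  have hτ : τ = Equiv.optionCongr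
      ((prodCongrRight φ).trans (prodCongrLeft fun _ : Bool => ρ)) := by
    ext1 x
    rcases x with _ | ⟨i, b⟩
    · simpa using h0
    · rw [h1]
      cases hs : s i <;> cases b <;> simp [φ, hs, ρ]
  rw [hτ, optionCongr_sign, Perm.sign_trans, Perm.sign_prodCongrLeft, Perm.sign_prodCongrRight]
  simp only [Fintype.prod_bool, Int.units_mul_self, one_mul, φ]
  push_cast
  refine Finset.prod_congr rfl fun i _ => ?_
  cases s i <;> simp

variable {T : Type*} {k : ℕ}

/-- The alternation of `α ⊗ Ω ⊗ ⋯ ⊗ Ω` does not vanish on a vector transverse to `ker α` followed by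
a symplectic family in `ker α`: all of its nonzero terms are equal. -/
theorem alternation_ne_zero {α : T → ℂ} {Ω : T → T → ℂ} {u : Option (Fin k × Bool) → T}
    (h0 : α (u none) ≠ 0) (h1 : ∀ a, α (u (some a)) = 0)
    (h2 : ∀ i j b, Ω (u (some (i, b))) (u (some (j, b))) = 0)
    (h3 : ∀ i j, Ω (u (some (i, false))) (u (some (j, true))) = if i = j then 1 else 0)
    (h4 : ∀ i j, Ω (u (some (i, true))) (u (some (j, false))) = if i = j then -1 else 0) :
    ∑ τ : Perm (Option (Fin k × Bool)), ((Perm.sign τ : ℤ) : ℂ) * (α (u (τ none)) *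
      ∏ i : Fin k, Ω (u (τ (some (i, false)))) (u (τ (some (i, true))))) ≠ 0 := by
  classical
  set f : Perm (Option (Fin k × Bool)) → ℂ := fun τ => ((Perm.sign τ : ℤ) : ℂ) *
    (α (u (τ none)) * ∏ i : Fin k, Ω (u (τ (some (i, false)))) (u (τ (some (i, true))))) with hf
  have hsymp : ∀ x y : Fin k × Bool, Ω (u (some x)) (u (some y)) ≠ 0 →
      y = (x.1, !x.2) ∧ Ω (u (some x)) (u (some y)) = if x.2 then -1 else 1 := by
    rintro ⟨i, _ | _⟩ ⟨j, _ | _⟩ h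
    · exact absurd (h2 _ _ _) h
    · by_cases hij : i = j <;> simp_all
    · by_cases hij : i = j <;> simp_all
    · exact absurd (h2 _ _ _) h
  have key : ∀ τ, f τ = if f τ ≠ 0 then α (u none) else 0 := by
    intro τ
    split_ifs with hne
    · have hα : α (u (τ none)) ≠ 0 := fun h => hne (by simp [hf, h])
      have hΩ : ∀ i, Ω (u (τ (some (i, false)))) (u (τ (some (i, true)))) ≠ 0 := fun i h =>
        hne (by simp only [hf]; rw [Finset.prod_eq_zero (Finset.mem_univ i) h]; simp)
      have hn : τ none = none := by
        by_contra hc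
        obtain ⟨a, ha⟩ := Option.ne_none_iff_exists'.1 hc
        exact hα (by rw [ha, h1])
      have hs : ∀ i : Fin k × Bool, ∃ a, τ (some i) = some a := fun i =>
        Option.ne_none_iff_exists'.1 fun hc => by
          have := τ.injective (hc.trans hn.symm)
          simp at this
      choose a ha using hs
      have hpair : ∀ i, a (i, true) = ((a (i, false)).1, !(a (i, false)).2) ∧
          Ω (u (τ (some (i, false)))) (u (τ (some (i, true)))) =
            if (a (i, false)).2 then -1 else 1 := by
        intro i
        have := hΩ i
        rw [ha, ha] at this ⊢
        exact hsymp _ _ this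
      have hsg := sign_of_map_pairs (π := fun i => (a (i, false)).1)
        (s := fun i => (a (i, false)).2) hn (by
          intro i b
          cases b
          · simp [ha]
          · rw [ha, (hpair i).1]; simp)
      simp only [hf]
      rw [Finset.prod_congr rfl fun i _ => (hpair i).2, hn, hsg, mul_left_comm]
      push_cast
      rw [← Finset.prod_mul_distrib, Finset.prod_eq_one, mul_one]
      intro i _
      cases (a (i, false)).2 <;> simp
    · simpa using hne
  rw [Finset.sum_congr rfl fun τ _ => key τ, ← Finset.sum_filter, Finset.sum_const, nsmul_eq_mul]
  refine mul_ne_zero (Nat.cast_ne_zero.2 (Finset.card_ne_zero.2 ⟨1, ?_⟩)) h0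
  simp only [Finset.mem_filter, Finset.mem_univ, true_and]
  simp [hf, h3, h0]

/-- The arrangement of the indices `0, 1, …, 2k` as one point and the `k` pairs `(2i+1, 2i+2)`. -/
noncomputable def pairEquiv (k : ℕ) : Option (Fin k × Bool) ≃ Fin (2 * k + 1) :=
  Equiv.ofBijective
    (fun x => x.elim 0 fun a => ⟨2 * a.1 + 1 + a.2.toNat, by
      have := a.2.toNat_le; have := a.1.2; omega⟩)
    ((Fintype.bijective_iff_injective_and_card _).2 ⟨by
      rintro (_ | ⟨i, b⟩) (_ | ⟨j, c⟩) h
      · rfl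
      · simp [Fin.ext_iff] at h; omega
      · simp [Fin.ext_iff] at h
      · simp only [Option.elim_some, Fin.mk.injEq] at h
        cases b <;> cases c <;> simp [Fin.ext_iff] at h ⊢ <;> omega, by
      simp [mul_comm]⟩)

theorem pairEquiv_none : pairEquiv k none = 0 := rfl

theorem pairEquiv_false (i : Fin k) :
    pairEquiv k (some (i, false)) = ⟨2 * i + 1, by omega⟩ := rfl

theorem pairEquiv_true (i : Fin k) :
    pairEquiv k (some (i, true)) = ⟨2 * i + 2, by omega⟩ := rfl

end Alternation

section Operations

variable {E : Type u} [NormedAddCommGroup E] [NormedSpace ℂ E]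
variable {F G : Type*} [NormedAddCommGroup F] [NormedSpace ℂ F]
  [NormedAddCommGroup G] [NormedSpace ℂ G]

theorem isSmoothHol_const (c : G) : IsSmoothHol fun _ : Phase E => c :=
  ⟨contDiff_const, fun _ => differentiable_const _⟩

theorem isSmoothHol_momentum : IsSmoothHol fun p : Phase E => p.2.1 :=
  ⟨contDiff_fst.comp contDiff_snd, fun _ => differentiable_snd⟩

theorem IsSmoothHol.clm_comp {f : Phase E → F} (hf : IsSmoothHol f) (A : F →L[ℂ] G) :
    IsSmoothHol fun p => A (f p) :=
  ⟨(A.restrictScalars ℝ).contDiff.comp hf.smooth, fun t => A.differentiable.comp (hf.hol t)⟩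

theorem IsSmoothHol.sub {f g : Phase E → G} (hf : IsSmoothHol f) (hg : IsSmoothHol g) :
    IsSmoothHol fun p => f p - g p :=
  ⟨hf.smooth.sub hg.smooth, fun t => (hf.hol t).sub (hg.hol t)⟩

theorem IsSmoothHol.neg {f : Phase E → G} (hf : IsSmoothHol f) : IsSmoothHol fun p => -f p :=
  ⟨hf.smooth.neg, fun t => (hf.hol t).neg⟩

theorem IsSmoothHol.prodMk {f : Phase E → F} {g : Phase E → G} (hf : IsSmoothHol f)
    (hg : IsSmoothHol g) : IsSmoothHol fun p => (f p, g p) :=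
  ⟨hf.smooth.prodMk hg.smooth, fun t => (hf.hol t).prodMk (hg.hol t)⟩

theorem IsSmoothHol.clm_apply {f : Phase E → F →L[ℂ] G} {g : Phase E → F}
    (hf : IsSmoothHol f) (hg : IsSmoothHol g) : IsSmoothHol fun p => f p (g p) where
  smooth := by
    have : ContDiff ℝ ∞ fun p => (f p).restrictScalars ℝ :=
      (ContinuousLinearMap.restrictScalarsL ℂ F G ℝ ℝ).contDiff.comp hf.smooth
    exact this.clm_apply hg.smooth
  hol := fun t => (hf.hol t).clm_apply (hg.hol t)

end Operations

section Contact

variable {E : Type u} [NormedAddCommGroup E] [NormedSpace ℂ E]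

/-- `α ∧ (dα)^k` does not vanish on a vector transverse to `ker α` together with a symplectic family of
`k` pairs in `ker α`. -/
theorem contactVolume_ne_zero {α : Phase E → Tangent E →L[ℂ] ℂ} {p : Phase E} {k : ℕ}
    {u : Option (Fin k × Bool) → Tangent E}
    (h0 : α p (u none) ≠ 0) (h1 : ∀ a, α p (u (some a)) = 0)
    (h2 : ∀ i j b, extD α p (u (some (i, b))) (u (some (j, b))) = 0)
    (h3 : ∀ i j, extD α p (u (some (i, false))) (u (some (j, true))) = if i = j then 1 else 0)
    (h4 : ∀ i j, extD α p (u (some (i, true))) (u (some (j, false))) = if i = j then -1 else 0) :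
    contactVolume α k p (u ∘ (pairEquiv k).symm) ≠ 0 := by
  have key := alternation_ne_zero (α := fun x => α p x) (Ω := fun x y => extD α p x y)
    h0 h1 h2 h3 h4
  unfold contactVolume
  refine mul_ne_zero (one_div_ne_zero (pow_ne_zero _ two_ne_zero)) ?_
  convert key using 1
  refine (Fintype.sum_equiv (pairEquiv k).permCongr _ _ fun τ => ?_).symm
  rw [Equiv.Perm.sign_permCongr]
  simp [← pairEquiv_none, ← pairEquiv_false, ← pairEquiv_true, Equiv.permCongr_apply]

theorem contactForm_apply (H : Phase E → ℂ) (p : Phase E) (Y : Tangent E) :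
    contactForm H p Y = H p * Y.2.2 - p.2.1 Y.1 := rfl

variable {H : Phase E → ℂ}

theorem isSmoothHol_contactForm (hH : IsSmoothHol H) : IsSmoothHol (contactForm H) := by
  have h1 := hH.clm_comp (ContinuousLinearMap.toSpanSingleton ℂ
    (ContinuousLinearMap.snd ℂ (StrongDual ℂ E) ℂ ∘L
      ContinuousLinearMap.snd ℂ E (StrongDual ℂ E × ℂ)))
  let A : StrongDual ℂ E →L[ℂ] (Tangent E →L[ℂ] ℂ) :=
    (ContinuousLinearMap.compL ℂ (Tangent E) E ℂ).flip
      (ContinuousLinearMap.fst ℂ E (StrongDual ℂ E × ℂ))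
  have h2 := IsSmoothHol.clm_comp (F := StrongDual ℂ E) (G := Tangent E →L[ℂ] ℂ)
    (isSmoothHol_momentum (E := E)) A
  exact h1.sub h2

theorem diff_contactForm (hH : IsSmoothHol H) (p : Phase E) (Z Y : Tangent E) :
    diff (contactForm H) p Z Y = diff H p Z * Y.2.2 - Z.2.1 Y.1 := by
  have hc := isSmoothHol_contactForm hH
  have e1 : dW (contactForm H) p Z.1 Y = dW H p Z.1 * Y.2.2 := by
    have h1 := (hc.hasFDerivAt_fst p).clm_apply (hasFDerivAt_const Y p.1)
    have h2 := ((hH.hasFDerivAt_fst p).mul_const Y.2.2).sub_const (p.2.1 Y.1)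
    simpa [mul_comm] using congrArg (fun A => A Z.1) (h1.unique h2)
  have e2 : dPi (contactForm H) p Z.2.1 Y = dPi H p Z.2.1 * Y.2.2 - Z.2.1 Y.1 := by
    have h1 := (hc.hasFDerivAt_snd p).clm_apply (hasFDerivAt_const Y p.2.1)
    have h2 := ((hH.hasFDerivAt_snd p).mul_const Y.2.2).sub
      ((hasFDerivAt_id p.2.1).clm_apply (hasFDerivAt_const Y.1 p.2.1))
    simpa [mul_comm] using congrArg (fun A => A Z.2.1) (h1.unique h2)
  have e3 : dTime (contactForm H) p Y = dTime H p * Y.2.2 := by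
    have h1 := (ContinuousLinearMap.apply ℂ ℂ Y).restrictScalars ℝ |>.hasFDerivAt.comp_hasDerivAt
      p.2.2 (hc.hasDerivAt_time p)
    have h2 := ((hH.hasDerivAt_time p).mul_const Y.2.2).sub_const (p.2.1 Y.1)
    exact h1.unique h2
  simp only [diff_apply, add_apply, smul_apply, e1, e2, e3,
    smul_eq_mul]
  ring

theorem extD_contactForm (hH : IsSmoothHol H) (p : Phase E) (Z Y : Tangent E) :
    extD (contactForm H) p Z Y =
      diff H p Z * Y.2.2 - Z.2.1 Y.1 - (diff H p Y * Z.2.2 - Y.2.1 Z.1) := by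
  rw [← diff_contactForm hH, ← diff_contactForm hH]
  rfl

end Contact

/-! ### The kernel of the differential of the contact form -/

section Characteristic

variable {E : Type u} [NormedAddCommGroup E] [NormedSpace ℂ E]

/-- The Hamiltonian vector `(v, -∂H/∂W, 1)` at `p`, where `v` stands for `∂H/∂Π`. -/
noncomputable def charVec (H : Phase E → ℂ) (p : Phase E) (v : E) : Tangent E :=
  (v, -dW H p, 1)

variable {H : Phase E → ℂ} {p : Phase E} {v : E}

theorem contactForm_charVec (hv : ∀ ξ, dPi H p ξ = ξ v) :
    contactForm H p (charVec H p v) = -constraint H p := by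
  simp [contactForm_apply, charVec, constraint, hv]

theorem extD_charVec (hH : IsSmoothHol H) (hv : ∀ ξ, dPi H p ξ = ξ v) (Y : Tangent E) :
    extD (contactForm H) p (charVec H p v) Y = 0 := by
  rw [extD_contactForm hH, diff_apply, diff_apply, hv, hv]
  simp [charVec]
  ring

theorem extD_contactForm_swap (hH : IsSmoothHol H) (Z Y : Tangent E) :
    extD (contactForm H) p Z Y = -extD (contactForm H) p Y Z := by
  rw [extD_contactForm hH, extD_contactForm hH]
  ring

/-- The kernel of `dΘ` is spanned by the Hamiltonian vector. -/
theorem eq_smul_charVec (hH : IsSmoothHol H) (hv : ∀ ξ, dPi H p ξ = ξ v) {Z : Tangent E}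
    (hZ : ∀ Y, extD (contactForm H) p Z Y = 0) : Z = Z.2.2 • charVec H p v := by
  refine Prod.ext ?_ (Prod.ext ?_ ?_)
  · refine (NormedSpace.inclusionInDoubleDualLi (E := E) ℂ).injective ?_
    ext ξ
    have := hZ (0, ξ, 0)
    rw [extD_contactForm hH, diff_apply, diff_apply, hv, hv] at this
    simp at this
    change ξ Z.1 = ξ (Z.2.2 • v)
    rw [map_smul, smul_eq_mul]
    linear_combination this
  · ext y
    have := hZ (y, 0, 0)
    rw [extD_contactForm hH, diff_apply, diff_apply, hv, hv] at this
    simp at this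
    change Z.2.1 y = Z.2.2 * -(dW H p y)
    linear_combination -this
  · simp [charVec]

theorem contactForm_ne_zero (hv : ∀ ξ, dPi H p ξ = ξ v) (hε : constraint H p ≠ 0) :
    contactForm H p ≠ 0 := fun h => by
  have := contactForm_charVec hv
  rw [h] at this
  exact hε (by simpa using this.symm)

/-- `dΘ` is nondegenerate on `ker Θ`, since the kernel of `dΘ` is transverse to `ker Θ`. -/
theorem transverseForm_nondegenerate (hH : IsSmoothHol H) (hv : ∀ ξ, dPi H p ξ = ξ v)
    (hε : constraint H p ≠ 0) (X : hyperplane (contactForm H) p)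
    (hX : ∀ Y, transverseForm (contactForm H) p X Y = 0) : X = 0 := by
  have hmem : contactForm H p X.1 = 0 := X.2
  have key : ∀ Y, extD (contactForm H) p X.1 Y = 0 := by
    intro Y
    set c := contactForm H p Y / constraint H p
    have hY : Y + c • charVec H p v ∈ hyperplane (contactForm H) p := by
      change contactForm H p (Y + c • charVec H p v) = 0
      rw [map_add, map_smul, contactForm_charVec hv, smul_eq_mul, mul_neg,
        div_mul_cancel₀ _ hε, add_neg_cancel]
    have h1 : extD (contactForm H) p X.1 (Y + c • charVec H p v) = 0 := hX ⟨_, hY⟩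
    rwa [map_add, map_smul, extD_contactForm_swap hH _ (charVec H p v), extD_charVec hH hv, neg_zero,
      smul_zero, add_zero] at h1
  have h2 := eq_smul_charVec hH hv key
  rw [h2, map_smul, contactForm_charVec hv, smul_eq_mul, mul_neg, neg_eq_zero, mul_eq_zero] at hmem
  have h3 : X.1.2.2 = 0 := hmem.resolve_right hε
  refine Subtype.ext (h2.trans ?_)
  rw [h3]
  exact zero_smul ℂ (charVec H p v)

/-- The projection of `ker Θ` to `E × E'` along the Hamiltonian vector. -/
noncomputable def hyperplaneEquiv (hv : ∀ ξ, dPi H p ξ = ξ v) (hε : constraint H p ≠ 0) :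
    hyperplane (contactForm H) p ≃ₗ[ℂ] E × StrongDual ℂ E where
  toFun Z := (Z.1.1 - Z.1.2.2 • v, Z.1.2.1 + Z.1.2.2 • dW H p)
  map_add' Z Y := by
    ext1
    · simp [add_smul]; abel
    · simp [add_smul]; abel
  map_smul' c Z := by
    ext1
    · simp [smul_sub, mul_smul]
    · simp [mul_smul]
  invFun q := ⟨(q.1, q.2, 0) - (p.2.1 q.1 / constraint H p) • charVec H p v, by
    change contactForm H p _ = 0
    rw [map_sub, map_smul, contactForm_charVec hv, smul_eq_mul, mul_neg, div_mul_cancel₀ _ hε]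
    simp [contactForm_apply]⟩
  left_inv Z := by
    have hZ : contactForm H p Z.1 = 0 := Z.2
    have hc := contactForm_charVec hv
    rw [contactForm_apply] at hZ hc
    have h : p.2.1 (Z.1.1 - Z.1.2.2 • v) / constraint H p = -Z.1.2.2 := by
      rw [div_eq_iff hε, map_sub, map_smul, smul_eq_mul]
      simp only [charVec, mul_one] at hc
      linear_combination -hZ + Z.1.2.2 * hc
    apply Subtype.ext
    simp only [h]
    refine Prod.ext ?_ (Prod.ext ?_ ?_) <;> simp [charVec]
  right_inv q := by
    refine Prod.ext ?_ ?_ <;> simp [charVec]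

theorem rank_transverseForm (hH : IsSmoothHol H) (hv : ∀ ξ, dPi H p ξ = ξ v)
    (hε : constraint H p ≠ 0) :
    (transverseForm (contactForm H) p).rank = Module.rank ℂ (E × StrongDual ℂ E) := by
  rw [← (hyperplaneEquiv hv hε).rank_eq, LinearMap.rank]
  refine rank_range_of_injective _ ?_
  rw [injective_iff_map_eq_zero]
  intro X hX
  exact transverseForm_nondegenerate hH hv hε X fun Y => by rw [hX]; rfl

/-- If `2k` does not exceed the dimension of `E × E'`, then `k` does not exceed the dimension of `E`,
and the Hahn-Banach theorem gives dual functionals of `k` independent vectors. -/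
theorem exists_biorthogonal {k : ℕ} (h : ((2 * k : ℕ) : Cardinal) ≤
      Module.rank ℂ (E × StrongDual ℂ E)) :
    ∃ (a : Fin k → E) (ξ : Fin k → StrongDual ℂ E), ∀ i j, ξ j (a i) = if i = j then 1 else 0 := by
  have hk : (k : Cardinal) ≤ Module.rank ℂ E := by
    by_cases hfin : Module.Finite ℂ E
    · have e : Module.rank ℂ (StrongDual ℂ E) = Module.rank ℂ E := by
        rw [← (LinearMap.toContinuousLinearMap (𝕜 := ℂ) (E := E) (F' := ℂ)).rank_eq]
        exact (Module.dual_rank_eq.trans (Cardinal.lift_uzero _))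
      rw [rank_prod', e, ← Module.finrank_eq_rank] at h
      rw [← Module.finrank_eq_rank]
      norm_cast at h ⊢
      omega
    · exact (Cardinal.natCast_le_aleph0).trans
        (not_lt.1 fun hlt => hfin (Module.rank_lt_aleph0_iff.1 hlt))
  obtain ⟨a, ha⟩ := (Module.le_rank_iff (R := ℂ)).1 hk
  refine ⟨a, ?_⟩
  let b := Module.Basis.span ha
  have hfd : FiniteDimensional ℂ (Submodule.span ℂ (Set.range a)) :=
    FiniteDimensional.span_of_finite ℂ (Set.finite_range a)
  choose ξ hξ _ using fun j => exists_extension_norm_eq (Submodule.span ℂ (Set.range a))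
    (LinearMap.toContinuousLinearMap (b.coord j))
  refine ⟨ξ, fun i j => ?_⟩
  have : a i = (b i : E) := congrArg Subtype.val (Module.Basis.span_apply ha i).symm
  rw [this, hξ]
  simp [Finsupp.single_apply]

/-- The vectors are the Hamiltonian vector and `k` canonical pairs, transported to `ker Θ`. -/
theorem exists_contactVolume_ne_zero (hH : IsSmoothHol H) (hv : ∀ ξ, dPi H p ξ = ξ v)
    (hε : constraint H p ≠ 0) {k : ℕ}
    (hk : ((2 * k : ℕ) : Cardinal) ≤ (transverseForm (contactForm H) p).rank) :
    ∃ w, contactVolume (contactForm H) k p w ≠ 0 := by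
  rw [rank_transverseForm hH hv hε] at hk
  obtain ⟨a, ξ, haξ⟩ := exists_biorthogonal hk
  let Φ := (hyperplaneEquiv hv hε).symm
  -- `dΘ` is the canonical symplectic form in the coordinates of `hyperplaneEquiv`
  have hΦ : ∀ q r, extD (contactForm H) p (Φ q).1 (Φ r).1 = r.2 q.1 - q.2 r.1 := by
    intro q r
    have e : ∀ q, (Φ q).1 = (q.1, q.2, 0) - (p.2.1 q.1 / constraint H p) • charVec H p v :=
      fun _ => rfl
    have h0 : ∀ Z, extD (contactForm H) p Z (charVec H p v) = 0 := fun Z => by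
      rw [extD_contactForm_swap hH, extD_charVec hH hv, neg_zero]
    rw [e, e, map_sub, map_smul, h0, map_sub, map_smul, sub_apply, smul_apply, extD_charVec hH hv,
      extD_contactForm hH]
    simp
    ring
  let w : Option (Fin k × Bool) → Tangent E := fun x => x.elim (charVec H p v)
    fun a' => (Φ (if a'.2 then (0, ξ a'.1) else (a a'.1, 0))).1
  refine ⟨_, contactVolume_ne_zero (u := w) ?_ ?_ ?_ ?_ ?_⟩
  · simp [w, contactForm_charVec hv, hε]
  · intro x
    exact (Φ _).2
  · rintro i j (_ | _) <;> simp [w, hΦ]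
  · intro i j
    simp [w, hΦ, haξ]
  · intro i j
    simp only [w, Option.elim_some, hΦ]
    simp [haξ, eq_comm (a := j)]
    split_ifs <;> simp

theorem rank_tangent {n : ℕ} (h : Module.rank ℂ (E × StrongDual ℂ E) = ((2 * n : ℕ) : Cardinal)) :
    Module.rank ℂ (Tangent E) = ((2 * n + 1 : ℕ) : Cardinal) := by
  rw [rank_prod'] at h
  rw [rank_prod', rank_prod, ← add_assoc, Nat.cast_add, ← h]
  simp

end Characteristic

/-! ### The characteristic vector field and its flow -/

/-- The product rule for complex linear maps that depend on a real parameter. -/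
theorem hasDerivWithinAt_clm_apply_complex {F G : Type*} [NormedAddCommGroup F] [NormedSpace ℂ F]
    [NormedAddCommGroup G] [NormedSpace ℂ G] {c : ℝ → F →L[ℂ] G} {c' : F →L[ℂ] G} {u : ℝ → F}
    {u' : F} {t : ℝ} {I : Set ℝ} (hc : HasDerivWithinAt c c' I t)
    (hu : HasDerivWithinAt u u' I t) :
    HasDerivWithinAt (fun s => c s (u s)) (c' (u t) + c t u') I t := by
  have h : HasDerivWithinAt (fun s => (c s).restrictScalars ℝ) (c'.restrictScalars ℝ) I t :=
    (ContinuousLinearMap.restrictScalarsL ℂ F G ℝ ℝ).hasFDerivAt.comp_hasDerivWithinAt t hc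
  exact h.clm_apply hu

theorem hasDerivAt_clm_apply_complex {F G : Type*} [NormedAddCommGroup F] [NormedSpace ℂ F]
    [NormedAddCommGroup G] [NormedSpace ℂ G] {c : ℝ → F →L[ℂ] G} {c' : F →L[ℂ] G} {u : ℝ → F}
    {u' : F} {t : ℝ} (hc : HasDerivAt c c' t) (hu : HasDerivAt u u' t) :
    HasDerivAt (fun s => c s (u s)) (c' (u t) + c t u') t := by
  rw [← hasDerivWithinAt_univ] at *
  exact hasDerivWithinAt_clm_apply_complex hc hu

/-- The exchange of a partial derivative in time with a partial derivative in space. -/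
theorem hasDerivAt_fderiv_right {P Q : Type*} [NormedAddCommGroup P] [NormedSpace ℝ P]
    [NormedAddCommGroup Q] [NormedSpace ℝ Q] {Φ : ℝ × P → Q} {r : ℝ} {p : P}
    (h : ContDiffAt ℝ 2 Φ (r, p)) (Y : P) :
    HasDerivAt (fun s => fderiv ℝ Φ (s, p) (0, Y))
      (fderiv ℝ (fun q => fderiv ℝ Φ q (1, 0)) (r, p) (0, Y)) r := by
  have hΦ1 : DifferentiableAt ℝ (fderiv ℝ Φ) (r, p) :=
    (h.fderiv_right (m := 1) (by norm_num)).differentiableAt (by simp)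
  have hline : HasDerivAt (fun s : ℝ => (s, p)) ((1 : ℝ), (0 : P)) r :=
    (hasDerivAt_id r).prodMk (hasDerivAt_const r p)
  have h1 : HasDerivAt (fun s => fderiv ℝ Φ (s, p)) (fderiv ℝ (fderiv ℝ Φ) (r, p) (1, 0)) r :=
    hΦ1.hasFDerivAt.comp_hasDerivAt r hline
  have h2 := h1.clm_apply (hasDerivAt_const r ((0 : ℝ), Y))
  have h3 := (hΦ1.hasFDerivAt.clm_apply (hasFDerivAt_const ((1 : ℝ), (0 : P)) (r, p))).fderiv
  rw [map_zero, add_zero, h.isSymmSndFDerivAt (by simp)] at h2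
  rw [h3]
  simpa using h2

/-- The derivative of a smooth holomorphic function along a curve. -/
theorem IsSmoothHol.comp_hasDerivAt {E : Type u} [NormedAddCommGroup E] [NormedSpace ℂ E]
    {G : Type*} [NormedAddCommGroup G] [NormedSpace ℂ G] {f : Phase E → G} (hf : IsSmoothHol f)
    {γ : ℝ → Phase E} {γ' : Phase E} {t : ℝ} (hγ : HasDerivAt γ γ' t) :
    HasDerivAt (fun s => f (γ s)) (diff f (γ t) (incl γ')) t :=
  (hf.hasFDerivAt (γ t)).comp_hasDerivAt t hγ

section VectorField

variable {E : Type u} [NormedAddCommGroup E] [NormedSpace ℂ E]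
variable {H : Phase E → ℂ}

/-- A field that represents the holomorphic functional derivative `∂H/∂Π` is itself smooth and
holomorphic: `E` sits isometrically in its bidual. -/
theorem isSmoothHol_of_dPi [CompleteSpace E] (hH : IsSmoothHol H) {V : Phase E → E}
    (hV : ∀ p ξ, dPi H p ξ = ξ (V p)) : IsSmoothHol V where
  smooth := by
    let J : E →ₗᵢ[ℝ] (StrongDual ℂ E →L[ℂ] ℂ) :=
      { toFun := NormedSpace.inclusionInDoubleDualLi ℂ
        map_add' := map_add _
        map_smul' := fun c x => (NormedSpace.inclusionInDoubleDualLi ℂ).map_smul (c : ℂ) x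
        norm_map' := (NormedSpace.inclusionInDoubleDualLi ℂ).norm_map }
    refine contDiff_of_comp_isometry (G := StrongDual ℂ E →L[ℂ] ℂ) J ?_
    have e : (fun p => J (V p)) = dPi H := by
      funext p; ext ξ; exact (hV p ξ).symm
    have := hH.dPi.smooth
    rw [← e] at this
    exact this
  hol := fun t q => by
    have e : (fun q : E × StrongDual ℂ E => NormedSpace.inclusionInDoubleDualLi ℂ (V (q.1, q.2, t)))
        = fun q => dPi H (q.1, q.2, t) := by
      funext q; ext ξ; exact (hV _ ξ).symm
    have h := (hH.dPi.hol t q).hasFDerivAt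
    rw [← e] at h
    obtain ⟨L, hL, -⟩ := exists_hasFDerivAt_of_comp_isometry
      (F := E) (G := StrongDual ℂ (StrongDual ℂ E)) (x := q)
      (L := fderiv ℂ (fun q : E × StrongDual ℂ E =>
        NormedSpace.inclusionInDoubleDualLi ℂ (V (q.1, q.2, t))) q)
      (f := fun q : E × StrongDual ℂ E => V (q.1, q.2, t))
      (NormedSpace.inclusionInDoubleDualLi (E := E) ℂ) (by exact h)
    exact hL.differentiableAt

theorem isSmoothHol_charVec [CompleteSpace E] (hH : IsSmoothHol H) {V : Phase E → E}
    (hV : ∀ p ξ, dPi H p ξ = ξ (V p)) : IsSmoothHol fun p => charVec H p (V p) :=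
  (isSmoothHol_of_dPi hH hV).prodMk (hH.dW.neg.prodMk (isSmoothHol_const 1))

theorem isSmoothHol_constraint (hH : IsSmoothHol H) : IsSmoothHol (constraint H) :=
  (hH.dPi.clm_apply isSmoothHol_momentum).sub hH

theorem constraint_eq (hH : IsSmoothHol H) (hdε : ∀ p, diff (constraint H) p = 0)
    (p q : Phase E) : constraint H p = constraint H q := by
  have hs := isSmoothHol_constraint hH
  refine is_const_of_fderiv_eq_zero (𝕜 := ℝ) (hs.smooth.differentiable (by simp)) (fun r => ?_) p q
  refine ContinuousLinearMap.ext fun Y => ?_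
  rw [hs.fderiv_apply, hdε]
  rfl

theorem isCharacteristic_charVec (hH : IsSmoothHol H) {V : Phase E → E}
    (hV : ∀ p ξ, dPi H p ξ = ξ (V p)) : IsCharacteristic H fun p => charVec H p (V p) :=
  fun p => ⟨contactForm_charVec (hV p), extD_charVec hH (hV p)⟩

theorem IsCharacteristic.eq_charVec (hH : IsSmoothHol H) {V : Phase E → E}
    (hV : ∀ p ξ, dPi H p ξ = ξ (V p)) (hε : ∀ p, constraint H p ≠ 0) {Y : Phase E → Tangent E}
    (hY : IsCharacteristic H Y) : Y = fun p => charVec H p (V p) := by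
  funext p
  have h1 := eq_smul_charVec hH (hV p) (hY p).2
  have h2 := (hY p).1
  rw [h1, map_smul, contactForm_charVec (hV p), smul_eq_mul, mul_neg, neg_inj] at h2
  have h3 : (Y p).2.2 = 1 := mul_right_cancel₀ (hε p) (by rw [h2, one_mul])
  rw [h3] at h1
  exact h1.trans (one_smul ℂ (charVec H p (V p)))

/-- Cartan's formula for a vector field with `ι_X Θ = -ε` and `ι_X dΘ = 0`: the Lie derivative
`L_X Θ = d(ι_X Θ) + ι_X dΘ` vanishes if `dε = 0`. -/
theorem IsCharacteristic.lieD_eq_zero (hH : IsSmoothHol H) (hdε : ∀ p, diff (constraint H) p = 0)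
    {X : Phase E → Tangent E} (hX : IsSmoothHol X) (hc : IsCharacteristic H X) (p : Phase E)
    (Y : Tangent E) : lieD X (contactForm H) p Y = 0 := by
  have hα := isSmoothHol_contactForm hH
  have hs := isSmoothHol_constraint hH
  have hαX : (fun p => contactForm H p (X p)) = fun p => -constraint H p :=
    funext fun p => (hc p).1
  obtain ⟨hdW, hdPi, hdT⟩ := partial_eq_zero_of_diff_eq_zero (hdε p)
  have e1 : dW (contactForm H) p Y.1 (X p) + contactForm H p (dW X p Y.1) = 0 := by
    have h1 := (hα.hasFDerivAt_fst p).clm_apply (hX.hasFDerivAt_fst p)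
    have h2 := (hs.hasFDerivAt_fst p).neg
    rw [hdW] at h2
    have := h1.unique (h2.congr_of_eventuallyEq (Eventually.of_forall fun w =>
      congrFun hαX (w, p.2.1, p.2.2)))
    simpa [add_comm] using congrArg (fun A => A Y.1) this
  have e2 : dPi (contactForm H) p Y.2.1 (X p) + contactForm H p (dPi X p Y.2.1) = 0 := by
    have h1 := (hα.hasFDerivAt_snd p).clm_apply (hX.hasFDerivAt_snd p)
    have h2 := (hs.hasFDerivAt_snd p).neg
    rw [hdPi] at h2
    have := h1.unique (h2.congr_of_eventuallyEq (Eventually.of_forall fun ξ =>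
      congrFun hαX (p.1, ξ, p.2.2)))
    simpa [add_comm] using congrArg (fun A => A Y.2.1) this
  have e3 : dTime (contactForm H) p (X p) + contactForm H p (dTime X p) = 0 := by
    have h1 := hasDerivAt_clm_apply_complex (hα.hasDerivAt_time p) (hX.hasDerivAt_time p)
    have h2 := (hs.hasDerivAt_time p).neg
    rw [hdT] at h2
    have := h1.unique (h2.congr_of_eventuallyEq (Eventually.of_forall fun s =>
      congrFun hαX (p.1, p.2.1, s)))
    simpa using this
  have hcart : diff (contactForm H) p (X p) Y = diff (contactForm H) p Y (X p) := by
    have := (hc p).2 Y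
    exact sub_eq_zero.1 this
  rw [lieD, hcart, diff_apply, diff_apply, map_add, map_add, map_smul, add_apply, add_apply,
    smul_apply]
  simp only [smul_eq_mul]
  linear_combination e1 + e2 + Y.2.2 * e3

/-- A local flow preserves a one-form with vanishing Lie derivative: the derivative of the pulled
back form along the flow is the Lie derivative. The `C²` hypothesis allows to exchange the
derivatives in time and in the initial point. -/
theorem IsLocalFlow.pullback_eq {X : Phase E → Tangent E} (hX : IsSmoothHol X)
    {α : Phase E → Tangent E →L[ℂ] ℂ} (hα : IsSmoothHol α) (hlie : ∀ p Y, lieD X α p Y = 0)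
    {U : Set (Phase E)} {δ : ℝ} {φ : ℝ → Phase E → Phase E} (hφ : IsLocalFlow X U δ φ)
    {s : ℝ} (hs : s ∈ Ioo (-δ) δ) {p : Phase E} (hp : p ∈ U) (Y : Phase E) :
    α (φ s p) (incl (fderiv ℝ (φ s) p Y)) = α p (incl Y) := by
  set Φ : ℝ × Phase E → Phase E := fun q => φ q.1 q.2
  set O : Set (ℝ × Phase E) := Ioo (-δ) δ ×ˢ U
  have hO : IsOpen O := isOpen_Ioo.prod hφ.isOpen
  have hΦ : ∀ q ∈ O, ContDiffAt ℝ 2 Φ q := fun q hq =>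
    (hφ.regular q hq).contDiffAt (hO.mem_nhds hq)
  have hΦd : ∀ q ∈ O, DifferentiableAt ℝ Φ q := fun q hq => (hΦ q hq).differentiableAt (by simp)
  have hm : ∀ r ∈ Ioo (-δ) δ, fderiv ℝ (φ r) p Y = fderiv ℝ Φ (r, p) (0, Y) := by
    intro r hr
    have := (HasFDerivAt.comp (f := fun x : Phase E => (r, x)) p (hΦd (r, p) ⟨hr, hp⟩).hasFDerivAt
      (hasFDerivAt_prodMk_right r p)).fderiv
    exact congrArg (fun A => A Y) this
  have ht : ∀ q ∈ O, incl (fderiv ℝ Φ q (1, 0)) = X (Φ q) := by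
    intro q hq
    have h1 := HasFDerivAt.comp_hasDerivAt (f := fun x : ℝ => (x, q.2)) q.1
      (hΦd q hq).hasFDerivAt ((hasDerivAt_id q.1).prodMk (hasDerivAt_const q.1 q.2))
    have h2 := (inclL (E := E)).hasFDerivAt.comp_hasDerivAt q.1 h1
    exact h2.unique (hφ.deriv q.1 hq.1 q.2 hq.2)
  have hder : ∀ r ∈ Ioo (-δ) δ,
      HasDerivAt (fun r => α (Φ (r, p)) (incl (fderiv ℝ Φ (r, p) (0, Y)))) 0 r := by
    intro r hr
    have hq : (r, p) ∈ O := ⟨hr, hp⟩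
    set m := fderiv ℝ Φ (r, p) (0, Y) with hmdef
    have hm' := hasDerivAt_fderiv_right (hΦ _ hq) Y
    have hmd := (inclL (E := E)).hasFDerivAt.comp_hasDerivAt r hm'
    have hX' : inclL (fderiv ℝ (fun q => fderiv ℝ Φ q (1, 0)) (r, p) (0, Y)) =
        diff X (Φ (r, p)) (incl m) := by
      have h1 : DifferentiableAt ℝ (fun q => fderiv ℝ Φ q (1, 0)) (r, p) :=
        (((hΦ _ hq).fderiv_right (m := 1) (by norm_num)).clm_apply contDiffAt_const).differentiableAt
          (by simp)
      have h2 := (inclL (E := E)).hasFDerivAt.comp (r, p) h1.hasFDerivAt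
      have h3 := (hX.hasFDerivAt (Φ (r, p))).comp (r, p) (hΦd _ hq).hasFDerivAt
      have h4 := h2.unique (h3.congr_of_eventuallyEq
        (eventually_of_mem (hO.mem_nhds hq) fun q hq => ht q hq))
      exact congrArg (fun A => A ((0 : ℝ), Y)) h4
    have h1 := HasFDerivAt.comp_hasDerivAt (f := fun x : ℝ => (x, p)) r
      (hΦd _ hq).hasFDerivAt ((hasDerivAt_id r).prodMk (hasDerivAt_const r p))
    have hαd := hα.comp_hasDerivAt h1
    have this := hasDerivAt_clm_apply_complex hαd hmd
    have hXr : incl (fderiv ℝ Φ (r, p) (1, 0)) = X (Φ (r, p)) := ht _ hq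
    simp only [Function.comp_apply, hXr] at this
    rw [hX'] at this
    have hz := hlie (Φ (r, p)) (incl m)
    rw [lieD] at hz
    rw [← hz]
    exact this
  have h0 : (0 : ℝ) ∈ Ioo (-δ) δ := by
    constructor <;> linarith [hs.1, hs.2]
  have hconst := isOpen_Ioo.is_const_of_deriv_eq_zero isPreconnected_Ioo
    (fun r hr => (hder r hr).differentiableAt.differentiableWithinAt)
    (fun r hr => (hder r hr).deriv) hs h0
  have hid : fderiv ℝ (φ 0) p = ContinuousLinearMap.id ℝ _ := by
    have : φ 0 =ᶠ[𝓝 p] id := eventually_of_mem (hφ.isOpen.mem_nhds hp) fun x hx => hφ.zero x hx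
    rw [this.fderiv_eq, fderiv_id]
  rw [hm s hs]
  refine hconst.trans ?_
  rw [← hm 0 h0, hid]
  simp [Φ, hφ.zero p hp]

end VectorField

/-! ### Conjugate fields of jets -/

section JetBundle

variable {E : Type u} [NormedAddCommGroup E] [NormedSpace ℂ E] [MeasurableSpace E]
  {vol : Measure E}

theorem hasSum_conjugateField {B : JetCoefficients E} {j : StochasticJet vol}
    {Pi : StrongDual ℂ E} (h : IsConjugateField B j Pi) (H : Phase E → ℂ) (t : ℝ)
    (Y : Tangent E) :
    HasSum (fun k => B k j.base (j.coeff (k + 1)) Y.1)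
      (H (j.base, Pi, t) * Y.2.2 - contactForm H (j.base, Pi, t) Y) := by
  have h1 := (ContinuousLinearMap.apply ℂ ℂ Y.1).hasSum h
  have e : H (j.base, Pi, t) * Y.2.2 - contactForm H (j.base, Pi, t) Y = Pi Y.1 := by
    rw [contactForm_apply]
    ring
  rw [e]
  exact h1

variable [BorelSpace E]

/-- The density `P g` of a probability measure, for a weight `g` of mean one with respect to the
probability measure with density `P`. -/
theorem isProbabilityMeasure_mul (P : ProbabilityFunctional vol) {g : E → ℝ} (hg : Continuous g)
    (hg0 : ∀ W, 0 ≤ g W)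
    (hint : Integrable g (vol.withDensity fun W => ENNReal.ofReal (P.density W)))
    (h1 : ∫ W, g W ∂(vol.withDensity fun W => ENNReal.ofReal (P.density W)) = 1) :
    IsProbabilityMeasure (vol.withDensity fun W => ENNReal.ofReal (P.density W * g W)) := by
  have hP : Measurable fun W => ENNReal.ofReal (P.density W) :=
    P.smooth.continuous.measurable.ennreal_ofReal
  refine ⟨?_⟩
  rw [withDensity_apply _ MeasurableSet.univ, Measure.restrict_univ]
  have := lintegral_withDensity_eq_lintegral_mul vol hP hg.measurable.ennreal_ofReal
  rw [← ofReal_integral_eq_lintegral_ofReal hint (Eventually.of_forall hg0), h1,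
    ENNReal.ofReal_one] at this
  rw [this]
  refine lintegral_congr fun W => ?_
  exact ENNReal.ofReal_mul (P.nonneg W)

/-- If `ℙ` contains a positive density `P`, every real covector at every point is the derivative of
an element of `ℙ`. It has the form `P (1 + sin m / 2) / Z` with a real affine function `m` that
vanishes at the point and the normalizing constant `Z ∈ [1/2, 3/2]`. The derivative of `m` that is
needed depends on `Z`, so that `Z` has to be found as a fixed point. -/
theorem exists_fderiv_density (P : ProbabilityFunctional vol) (hP : ∀ W, 0 < P.density W)
    (W₀ : E) (ℓ : E →L[ℝ] ℝ) :
    ∃ Q : ProbabilityFunctional vol, fderiv ℝ Q.density W₀ = ℓ := by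
  set μ := vol.withDensity fun W => ENNReal.ofReal (P.density W)
  have hμ : IsProbabilityMeasure μ := P.isProb
  let m : ℝ → E →L[ℝ] ℝ := fun z => (2 / P.density W₀) • (z • ℓ - fderiv ℝ P.density W₀)
  let f : ℝ → E → ℝ := fun z W => 1 + Real.sin (m z (W - W₀)) / 2
  have hmc : ∀ W, Continuous fun z => m z (W - W₀) := fun W => by
    simp only [m, smul_apply, sub_apply, smul_eq_mul]
    fun_prop
  have hfs : ∀ z, ContDiff ℝ ∞ (f z) := fun z => by
    have : ContDiff ℝ ∞ fun W => m z (W - W₀) :=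
      (m z).contDiff.comp (contDiff_id.sub contDiff_const)
    exact contDiff_const.add (this.sin.div_const 2)
  have hfb : ∀ z W, f z W ∈ Icc (1 / 2 : ℝ) (3 / 2) := fun z W => by
    have h1 := Real.neg_one_le_sin (m z (W - W₀))
    have h2 := Real.sin_le_one (m z (W - W₀))
    constructor <;> simp only [f] <;> linarith
  have hfint : ∀ z, Integrable (f z) μ := fun z =>
    (integrable_const (3 / 2 : ℝ)).mono' (hfs z).continuous.aestronglyMeasurable
      (Eventually.of_forall fun W => by
        rw [Real.norm_of_nonneg (by linarith [(hfb z W).1])]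
        exact (hfb z W).2)
  have hcont : Continuous fun z => ∫ W, f z W ∂μ := by
    refine continuous_of_dominated (bound := fun _ => 3 / 2)
      (fun z => (hfs z).continuous.aestronglyMeasurable)
      (fun z => Eventually.of_forall fun W => ?_) (integrable_const _)
      (Eventually.of_forall fun W => ?_)
    · rw [Real.norm_of_nonneg (by linarith [(hfb z W).1])]
      exact (hfb z W).2
    · exact continuous_const.add ((Real.continuous_sin.comp (hmc W)).div_const 2)
  have hmaps : MapsTo (fun z => ∫ W, f z W ∂μ) (Icc (1 / 2 : ℝ) (3 / 2)) (Icc (1 / 2) (3 / 2)) := by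
    intro z _
    have hlo := integral_mono (integrable_const (1 / 2 : ℝ)) (hfint z) fun W => (hfb z W).1
    have hhi := integral_mono (hfint z) (integrable_const (3 / 2 : ℝ)) fun W => (hfb z W).2
    rw [integral_const, probReal_univ, one_smul] at hlo hhi
    exact ⟨hlo, hhi⟩
  obtain ⟨z, hz, hfix⟩ := exists_mem_Icc_isFixedPt_of_mapsTo hcont.continuousOn (by norm_num) hmaps
  have hz0 : 0 < z := by linarith [hz.1]
  have hfix' : ∫ W, f z W ∂μ = z := hfix
  have hgs : ContDiff ℝ ∞ fun W => f z W / z := (hfs z).div_const z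
  have hg0 : ∀ W, 0 ≤ f z W / z := fun W => div_nonneg (by linarith [(hfb z W).1]) hz0.le
  refine ⟨⟨fun W => P.density W * (f z W / z), P.smooth.mul hgs,
    fun W => mul_nonneg (P.nonneg W) (hg0 W),
    isProbabilityMeasure_mul P hgs.continuous hg0 ((hfint z).div_const z) ?_⟩, ?_⟩
  · rw [integral_div, hfix', div_self hz0.ne']
  · have h1 : HasFDerivAt P.density (fderiv ℝ P.density W₀) W₀ :=
      ((P.smooth.differentiable (by simp)) W₀).hasFDerivAt
    have h2 : HasFDerivAt (fun W => m z (W - W₀)) (m z) W₀ := by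
      have := (m z).hasFDerivAt.comp W₀ ((hasFDerivAt_id W₀).sub_const W₀)
      rwa [ContinuousLinearMap.comp_id] at this
    have h3 : HasFDerivAt (fun W => f z W / z) ((1 / (2 * z)) • m z) W₀ := by
      have := ((h2.sin.const_mul (1 / 2)).const_add 1).const_mul (1 / z)
      refine (this.congr_fderiv ?_).congr_of_eventuallyEq (Eventually.of_forall fun W => ?_)
      · ext a
        simp
        field_simp
      · simp only [f]
        ring
    refine (h1.mul h3).fderiv.trans ?_
    ext a
    have hPne := (hP W₀).ne'
    simp [f, m]
    field_simp
    ring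

/-- Coefficients that read off the complex linear form whose real part is the first derivative of
the density. -/
noncomputable def firstOrderCoefficients : JetCoefficients E
  | 0 => fun _ =>
    (StrongDual.extendRCLikeL (𝕜 := ℂ) (F := E) : StrongDual ℝ E →L[ℝ] StrongDual ℂ E) ∘L
      ((continuousMultilinearCurryFin1 ℝ E ℝ).toContinuousLinearEquiv :
        (E [×1]→L[ℝ] ℝ) →L[ℝ] StrongDual ℝ E)
  | _ + 1 => fun _ => 0

theorem exists_jet (hvol : ∃ P : ProbabilityFunctional vol, ∀ W, 0 < P.density W) (W : E)
    (Pi : StrongDual ℂ E) :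
    ∃ j : StochasticJet vol, j.base = W ∧ IsConjugateField firstOrderCoefficients j Pi := by
  obtain ⟨P, hP⟩ := hvol
  obtain ⟨Q, hQ⟩ := exists_fderiv_density P hP W
    ((StrongDual.extendRCLikeL (𝕜 := ℂ) (F := E)).symm Pi)
  refine ⟨⟨W, fun k => iteratedFDeriv ℝ k Q.density W, Q, fun _ => rfl⟩, rfl, ?_⟩
  have h0 : firstOrderCoefficients (E := E) 0 W (iteratedFDeriv ℝ 1 Q.density W) = Pi := by
    have : continuousMultilinearCurryFin1 ℝ E ℝ (iteratedFDeriv ℝ 1 Q.density W) =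
        fderiv ℝ Q.density W := by
      ext a
      simp [iteratedFDeriv_one_apply]
    change StrongDual.extendRCLikeL (𝕜 := ℂ) (F := E)
      (continuousMultilinearCurryFin1 ℝ E ℝ (iteratedFDeriv ℝ 1 Q.density W)) = Pi
    rw [this, hQ, ContinuousLinearEquiv.apply_symm_apply]
  have := hasSum_single (f := fun k => firstOrderCoefficients (E := E) k W
    (iteratedFDeriv ℝ (k + 1) Q.density W)) 0 (by
      rintro (_ | k) hk
      · exact absurd rfl hk
      · rfl)
  rw [← h0]
  exact this

end JetBundle

/-! ### The action and its extremals -/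

/-- The fundamental lemma of the calculus of variations on a compact interval. -/
theorem eqOn_zero_of_integral_smul_eq_zero {u : ℝ → ℂ} (hu : Continuous u) {a b : ℝ} (hab : a < b)
    (h : ∀ g : ℝ → ℝ, ContDiff ℝ ∞ g → g a = 0 → g b = 0 → ∫ t in a..b, g t • u t = 0) :
    ∀ t ∈ Icc a b, u t = 0 := by
  have hae := isOpen_Ioo (a := a) (b := b) |>.ae_eq_zero_of_integral_contDiff_smul_eq_zero
    (μ := volume) (hu.locallyIntegrable.locallyIntegrableOn _) fun g hg _ hsupp => by
      have hout : ∀ x, x ∉ Ioo a b → g x = 0 := fun x hx =>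
        image_eq_zero_of_notMem_tsupport fun hx' => hx (hsupp hx')
      rw [← intervalIntegral.integral_eq_integral_of_support_subset]
      · exact h g hg (hout a (by simp)) (hout b (by simp))
      · intro x hx
        by_contra hx'
        exact hx (by simp [hout x fun h => hx' (Ioo_subset_Ioc_self h)])
  refine Measure.eqOn_Icc_of_ae_eq (μ := volume) (g := fun _ => (0 : ℂ)) hab.ne ?_ hu.continuousOn
    continuousOn_const
  rw [restrict_Ioo_eq_restrict_Icc.symm]
  exact (ae_restrict_iff' measurableSet_Ioo).2 hae

section Action

variable {E : Type u} [NormedAddCommGroup E] [NormedSpace ℂ E] {H : Phase E → ℂ}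

theorem isFlowLine_charVec_iff {V : Phase E → E} {W : ℝ → E} {Pi : ℝ → StrongDual ℂ E}
    {I : Set ℝ} : IsFlowLine (fun p => charVec H p (V p)) W Pi I ↔
      ∀ t ∈ I, HasDerivAt W (V (W t, Pi t, t)) t ∧ HasDerivAt Pi (-dW H (W t, Pi t, t)) t := by
  refine forall₂_congr fun t _ => ⟨fun h => ?_, fun h => ?_⟩
  · exact ⟨h.hasFDerivAt.fst.hasDerivAt.congr_deriv (by simp [charVec]),
      h.hasFDerivAt.snd.fst.hasDerivAt.congr_deriv (by simp [charVec])⟩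
  · exact h.1.prodMk (h.2.prodMk (hasDerivAt_id t).ofReal_comp)

theorem action_eq (H : Phase E → ℂ) (a b : ℝ) (W : ℝ → E) (Pi : ℝ → StrongDual ℂ E) :
    action H a b W Pi = ∫ t in a..b, (Pi t (deriv W t) - H (W t, Pi t, t)) := by
  rw [action, ← intervalIntegral.integral_neg]
  refine intervalIntegral.integral_congr fun t _ => ?_
  simp [contactForm_apply]

theorem fderiv_apply_variation {V : Phase E → E} (hV : ∀ p ξ, dPi H p ξ = ξ (V p))
    (p : Phase E) (ξ : StrongDual ℂ E) (w : E) (hH : IsSmoothHol H) :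
    fderiv ℝ H p (w, ξ, 0) = dW H p w + ξ (V p) := by
  simp [hH.fderiv_apply, incl, diff_apply, hV]

/-- The first variation of the action. -/
theorem hasDerivAt_action (hH : IsSmoothHol H) {a b : ℝ} {W w : ℝ → E} {Pi ξ : ℝ → StrongDual ℂ E}
    (hW : ContDiff ℝ 1 W) (hw : ContDiff ℝ 1 w) (hPi : ContDiff ℝ 1 Pi) (hξ : ContDiff ℝ 1 ξ) :
    HasDerivAt (fun s : ℝ => action H a b (fun t => W t + s • w t) (fun t => Pi t + s • ξ t))
      (∫ t in a..b, (ξ t (deriv W t) + Pi t (deriv w t) -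
        fderiv ℝ H (W t, Pi t, t) (w t, ξ t, 0))) 0 := by
  have hdW : Continuous (deriv W) := hW.continuous_deriv le_rfl
  have hdw : Continuous (deriv w) := hw.continuous_deriv le_rfl
  have cW := hW.continuous
  have cw := hw.continuous
  have cPi := hPi.continuous
  have cξ := hξ.continuous
  have cH := hH.smooth.continuous
  have cH' : Continuous (fderiv ℝ H) := hH.smooth.continuous_fderiv (by simp)
  let γ : ℝ → ℝ → Phase E := fun s t => (W t + s • w t, Pi t + s • ξ t, t)
  have cγ : Continuous fun q : ℝ × ℝ => γ q.1 q.2 := by fun_prop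
  let F : ℝ → ℝ → ℂ := fun s t => (Pi t + s • ξ t) (deriv W t + s • deriv w t) - H (γ s t)
  let F' : ℝ → ℝ → ℂ := fun s t => ξ t (deriv W t + s • deriv w t) +
    (Pi t + s • ξ t) (deriv w t) - fderiv ℝ H (γ s t) (w t, ξ t, 0)
  have cF : Continuous fun q : ℝ × ℝ => F q.1 q.2 := by
    refine Continuous.sub (Continuous.clm_apply ?_ ?_) (cH.comp cγ) <;> fun_prop
  have cF' : Continuous fun q : ℝ × ℝ => F' q.1 q.2 := by
    refine ((Continuous.clm_apply ?_ ?_).add (Continuous.clm_apply ?_ ?_)).sub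
      ((cH'.comp cγ).clm_apply ?_) <;> fun_prop
  have hact : (fun s : ℝ => action H a b (fun t => W t + s • w t) (fun t => Pi t + s • ξ t)) =
      fun s => ∫ t in a..b, F s t := by
    funext s
    rw [action_eq]
    refine intervalIntegral.integral_congr fun t _ => ?_
    have : deriv (fun t => W t + s • w t) t = deriv W t + s • deriv w t :=
      (((hW.differentiable one_ne_zero) t).hasDerivAt.add
        (((hw.differentiable one_ne_zero) t).hasDerivAt.const_smul s)).deriv
    simp only [this]
    rfl
  obtain ⟨C, hC⟩ := (isCompact_Icc.prod isCompact_uIcc).exists_bound_of_continuousOn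
    (s := Icc (-1 : ℝ) 1 ×ˢ uIcc a b) cF'.continuousOn
  have key := intervalIntegral.hasDerivAt_integral_of_dominated_loc_of_deriv_le
    (μ := volume) (a := a) (b := b) (F := F) (F' := F') (x₀ := 0) (s := Icc (-1) 1)
    (bound := fun _ => C)
    (Icc_mem_nhds (by norm_num) (by norm_num))
    (Eventually.of_forall fun s =>
      (cF.comp (continuous_const.prodMk continuous_id)).aestronglyMeasurable)
    ((cF.comp (continuous_const.prodMk continuous_id)).intervalIntegrable _ _)
    (cF'.comp (continuous_const.prodMk continuous_id)).aestronglyMeasurable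
    (Eventually.of_forall fun t ht s hs => hC (s, t) ⟨hs, uIoc_subset_uIcc ht⟩)
    intervalIntegrable_const
    (Eventually.of_forall fun t _ s _ => by
      have h1 : HasDerivAt (fun s : ℝ => Pi t + s • ξ t) (ξ t) s := by
        simpa using ((hasDerivAt_id s).smul_const (ξ t)).const_add (Pi t)
      have h2 : HasDerivAt (fun s : ℝ => deriv W t + s • deriv w t) (deriv w t) s := by
        simpa using ((hasDerivAt_id s).smul_const (deriv w t)).const_add (deriv W t)
      have h3 : HasDerivAt (fun s : ℝ => W t + s • w t) (w t) s := by
        simpa using ((hasDerivAt_id s).smul_const (w t)).const_add (W t)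
      have h4 : HasDerivAt (fun s => γ s t) (w t, ξ t, 0) s :=
        h3.prodMk (h1.prodMk (hasDerivAt_const s t))
      have h5 : HasDerivAt (fun s => H (γ s t)) (fderiv ℝ H (γ s t) (w t, ξ t, 0)) s :=
        ((hH.smooth.differentiable (by simp)) (γ s t)).hasFDerivAt.comp_hasDerivAt s h4
      exact (hasDerivAt_clm_apply_complex h1 h2).sub h5)
  rw [hact]
  refine key.2.congr_deriv ?_
  refine intervalIntegral.integral_congr fun t _ => ?_
  have e : Pi t + (0 : ℝ) • ξ t = Pi t := by
    rw [zero_smul ℝ (ξ t), add_zero]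
  simp [F', γ, e]

variable {V : Phase E → E}

/-- Along a flow line the integrand of the first variation is the derivative of `Π w`. -/
theorem IsFlowLine.isExtremal (hH : IsSmoothHol H) (hV : ∀ p ξ, dPi H p ξ = ξ (V p))
    {a b : ℝ} (hab : a < b) {W : ℝ → E} {Pi : ℝ → StrongDual ℂ E} (hW : ContDiff ℝ 1 W)
    (hPi : ContDiff ℝ 1 Pi) (h : IsFlowLine (fun p => charVec H p (V p)) W Pi (Icc a b)) :
    IsExtremal H a b W Pi := by
  intro w ξ hw hξ hwa hwb
  rw [isFlowLine_charVec_iff] at h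
  have hdw : ∀ t, HasDerivAt w (deriv w t) t := fun t =>
    ((hw.differentiable one_ne_zero) t).hasDerivAt
  have hdPi : ∀ t, HasDerivAt Pi (deriv Pi t) t := fun t =>
    ((hPi.differentiable one_ne_zero) t).hasDerivAt
  refine (hasDerivAt_action hH hW hw hPi hξ).congr_deriv ?_
  have hcongr : ∀ t ∈ uIcc a b, ξ t (deriv W t) + Pi t (deriv w t) -
      fderiv ℝ H (W t, Pi t, t) (w t, ξ t, 0) = deriv Pi t (w t) + Pi t (deriv w t) := by
    intro t ht
    rw [uIcc_of_le hab.le] at ht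
    rw [fderiv_apply_variation hV _ _ _ hH, (h t ht).1.deriv, (h t ht).2.deriv]
    simp
    ring
  rw [intervalIntegral.integral_congr hcongr, intervalIntegral.integral_eq_sub_of_hasDerivAt
    (fun t _ => hasDerivAt_clm_apply_complex (hdPi t) (hdw t)), hwa, hwb]
  · simp
  · refine Continuous.intervalIntegrable ?_ _ _
    exact ((hPi.continuous_deriv le_rfl).clm_apply hw.continuous).add
      (hPi.continuous.clm_apply (hw.continuous_deriv le_rfl))

theorem IsExtremal.isFlowLine (hH : IsSmoothHol H) (hV : ∀ p ξ, dPi H p ξ = ξ (V p))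
    (hVc : Continuous V) {a b : ℝ} (hab : a < b) {W : ℝ → E} {Pi : ℝ → StrongDual ℂ E}
    (hW : ContDiff ℝ 1 W) (hPi : ContDiff ℝ 1 Pi) (h : IsExtremal H a b W Pi) :
    IsFlowLine (fun p => charVec H p (V p)) W Pi (Icc a b) := by
  have hdW : ∀ t, HasDerivAt W (deriv W t) t := fun t =>
    ((hW.differentiable one_ne_zero) t).hasDerivAt
  have hdPi : ∀ t, HasDerivAt Pi (deriv Pi t) t := fun t =>
    ((hPi.differentiable one_ne_zero) t).hasDerivAt
  have cW := hW.continuous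
  have cPi := hPi.continuous
  have cdW : Continuous (deriv W) := hW.continuous_deriv le_rfl
  have cdPi : Continuous (deriv Pi) := hPi.continuous_deriv le_rfl
  have cγ : Continuous fun t => ((W t, Pi t, t) : Phase E) := by fun_prop
  have hvar : ∀ (w : ℝ → E) (ξ : ℝ → StrongDual ℂ E), ContDiff ℝ 1 w → ContDiff ℝ 1 ξ →
      w a = 0 → w b = 0 → ∫ t in a..b, (ξ t (deriv W t) + Pi t (deriv w t) -
        (dW H (W t, Pi t, t) (w t) + ξ t (V (W t, Pi t, t)))) = 0 := by
    intro w ξ hw hξ hwa hwb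
    have := (hasDerivAt_action hH hW hw hPi hξ).unique (h w ξ hw hξ hwa hwb)
    simpa only [fderiv_apply_variation hV _ _ _ hH] using this
  -- variations of `Π` alone
  have h1 : ∀ t ∈ Icc a b, deriv W t = V (W t, Pi t, t) := by
    intro t ht
    refine (NormedSpace.inclusionInDoubleDualLi (E := E) ℂ).injective ?_
    ext ξ₀
    refine sub_eq_zero.1 (eqOn_zero_of_integral_smul_eq_zero
      (u := fun t => ξ₀ (deriv W t) - ξ₀ (V (W t, Pi t, t)))
      ((ξ₀.continuous.comp cdW).sub (ξ₀.continuous.comp (hVc.comp cγ))) hab ?_ t ht)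
    intro g hg _ _
    rw [← hvar (fun _ => 0) (fun t => g t • ξ₀) contDiff_const
      ((hg.of_le (by simp)).smul contDiff_const) rfl rfl]
    refine intervalIntegral.integral_congr fun t _ => ?_
    simp [mul_sub]
  -- variations of `W` alone, with an integration by parts
  have h2 : ∀ t ∈ Icc a b, deriv Pi t = -dW H (W t, Pi t, t) := by
    intro t ht
    ext w₀
    have hc : Continuous fun t => deriv Pi t w₀ + dW H (W t, Pi t, t) w₀ :=
      (cdPi.clm_apply continuous_const).add
        ((hH.dW.smooth.continuous.comp cγ).clm_apply continuous_const)
    refine eq_neg_of_add_eq_zero_left (eqOn_zero_of_integral_smul_eq_zero hc hab ?_ t ht)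
    intro g hg hga hgb
    have hdg : ∀ t, HasDerivAt g (deriv g t) t := fun t =>
      ((hg.differentiable (by simp)) t).hasDerivAt
    have hdw : ∀ t, HasDerivAt (fun t => g t • w₀) (deriv g t • w₀) t := fun t =>
      (hdg t).smul_const w₀
    have cg := hg.continuous
    have cdg : Continuous (deriv g) := hg.continuous_deriv (by simp)
    have e1 := hvar (fun t => g t • w₀) (fun _ => 0) ((hg.of_le (by simp)).smul contDiff_const)
      contDiff_const (by simp [hga]) (by simp [hgb])
    have hparts : ∀ t, HasDerivAt (fun t => Pi t (g t • w₀))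
        (deriv Pi t (g t • w₀) + Pi t (deriv g t • w₀)) t := fun t =>
      hasDerivAt_clm_apply_complex (hdPi t) (hdw t)
    have cparts : Continuous fun t => deriv Pi t (g t • w₀) + Pi t (deriv g t • w₀) :=
      (cdPi.clm_apply (cg.smul continuous_const)).add (cPi.clm_apply (cdg.smul continuous_const))
    have e2 := intervalIntegral.integral_eq_sub_of_hasDerivAt (fun t _ => hparts t)
      (cparts.intervalIntegrable a b)
    simp only [hga, hgb, zero_smul, map_zero, sub_zero] at e2
    have cI : Continuous fun t => Pi t (deriv g t • w₀) - dW H (W t, Pi t, t) (g t • w₀) :=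
      (cPi.clm_apply (cdg.smul continuous_const)).sub
        ((hH.dW.smooth.continuous.comp cγ).clm_apply (cg.smul continuous_const))
    have e3 : ∫ t in a..b, (Pi t (deriv g t • w₀) - dW H (W t, Pi t, t) (g t • w₀)) = 0 := by
      rw [← e1]
      refine intervalIntegral.integral_congr fun t _ => ?_
      simp [(hdw t).deriv]
    have e4 := intervalIntegral.integral_sub (cparts.intervalIntegrable a b)
      (cI.intervalIntegrable (μ := volume) a b)
    rw [e2, e3, sub_zero] at e4
    rw [← e4]
    refine intervalIntegral.integral_congr fun t _ => ?_
    simp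
    ring
  rw [isFlowLine_charVec_iff]
  exact fun t ht => ⟨h1 t ht ▸ hdW t, h2 t ht ▸ hdPi t⟩

theorem IsFlowLine.action_eq_integral_constraint (hV : ∀ p ξ, dPi H p ξ = ξ (V p))
    {a b : ℝ} {W : ℝ → E} {Pi : ℝ → StrongDual ℂ E}
    (h : IsFlowLine (fun p => charVec H p (V p)) W Pi (uIcc a b)) :
    action H a b W Pi = ∫ t in a..b, constraint H (W t, Pi t, t) := by
  rw [isFlowLine_charVec_iff] at h
  rw [action_eq]
  refine intervalIntegral.integral_congr fun t ht => ?_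
  simp [constraint, hV, (h t ht).1.deriv]

/-- The derivative of a functional along a flow line, in terms of the bracket. -/
theorem IsFlowLine.hasDerivAt_comp (hV : ∀ p ξ, dPi H p ξ = ξ (V p)) {I : Set ℝ} {W : ℝ → E}
    {Pi : ℝ → StrongDual ℂ E} (h : IsFlowLine (fun p => charVec H p (V p)) W Pi I) {t : ℝ}
    (ht : t ∈ I) {F : Phase E → ℂ} (hF : IsSmoothHol F) :
    HasDerivAt (fun s => F (W s, Pi s, s))
      (bracket F H (W t, Pi t, t) + dTime F (W t, Pi t, t)) t := by
  rw [isFlowLine_charVec_iff] at h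
  have h1 := hF.comp_hasDerivAt ((h t ht).1.prodMk ((h t ht).2.prodMk (hasDerivAt_id t)))
  refine h1.congr_deriv ?_
  simp [diff_apply, incl, bracket, hV]
  ring

theorem bracket_field (hV : ∀ p ξ, dPi H p ξ = ξ (V p)) (ℓ : StrongDual ℂ E) (p : Phase E) :
    bracket (fun p => ℓ p.1) H p = ℓ (V p) := by
  have h1 : dW (fun p : Phase E => ℓ p.1) p = ℓ := ℓ.fderiv
  have h2 : dPi (fun p : Phase E => ℓ p.1) p = 0 := by
    simp only [dPi]
    exact fderiv_const_apply _
  simp [bracket, h1, h2, hV]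

theorem bracket_momentum (v : E) (p : Phase E) :
    bracket (fun p => p.2.1 v) H p = -dW H p v := by
  have h1 : dW (fun p : Phase E => p.2.1 v) p = 0 := by
    simp only [dW]
    exact fderiv_const_apply _
  have h2 : dPi (fun p : Phase E => p.2.1 v) p = ContinuousLinearMap.apply ℂ ℂ v :=
    (ContinuousLinearMap.apply ℂ ℂ v).fderiv
  simp [bracket, h1, h2]

end Action

/-! ### Neighbouring solutions of a time dependent vector field -/

section FlowBox

open Metric
open scoped NNReal

variable {E : Type u} [NormedAddCommGroup E] [NormedSpace ℂ E]

/-- A box around `(x₀, t₀)` on which the time dependent holomorphic vector field `f` and its complex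
derivative `A` are bounded by `M` and `K`, on which `A` is Lipschitz continuous with the constant
`L`, and which is so short in time that curves that pass through the inner ball of radius `ρ` stay
in the outer ball of radius `2ρ` and separate by a factor of two at most. -/
structure IsFlowBox (f : ℝ → E → E) (A : ℝ → E → E →L[ℂ] E) (x₀ : E) (t₀ ρ T M K L : ℝ) :
    Prop where
  pos_radius : 0 < ρ
  pos_time : 0 < T
  nonneg_bound : 0 ≤ M
  nonneg_deriv : 0 ≤ K
  nonneg_lip : 0 ≤ L
  contDiff : ContDiff ℝ 1 (Function.uncurry f)
  continuous_deriv : Continuous (Function.uncurry A)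
  hasFDerivAt : ∀ s x, HasFDerivAt (f s) (A s x) x
  norm_le : ∀ s ∈ Icc (t₀ - T) (t₀ + T), ∀ x ∈ closedBall x₀ (2 * ρ), ‖f s x‖ ≤ M
  norm_deriv_le : ∀ s ∈ Icc (t₀ - T) (t₀ + T), ∀ x ∈ closedBall x₀ (2 * ρ), ‖A s x‖ ≤ K
  lip_deriv : ∀ s ∈ Icc (t₀ - T) (t₀ + T), ∀ x ∈ closedBall x₀ (2 * ρ),
    ∀ y ∈ closedBall x₀ (2 * ρ), ‖A s y - A s x‖ ≤ L * ‖y - x‖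
  short : M * (2 * T) ≤ ρ
  short_deriv : K * (2 * T) ≤ 1 / 2

/-- A curve in the box that solves the differential equation of `f` at the times in `J`. -/
def IsBoxCurve (f : ℝ → E → E) (x₀ : E) (ρ : ℝ) (J : Set ℝ) (x : ℝ → E) : Prop :=
  ∀ s ∈ J, HasDerivWithinAt x (f s (x s)) J s ∧ x s ∈ closedBall x₀ (2 * ρ)

theorem IsBoxCurve.mono {f : ℝ → E → E} {x₀ : E} {ρ : ℝ} {J J' : Set ℝ} {x : ℝ → E}
    (h : IsBoxCurve f x₀ ρ J x) (hJ : J' ⊆ J) : IsBoxCurve f x₀ ρ J' x :=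
  fun s hs => ⟨(h s (hJ hs)).1.mono hJ, (h s (hJ hs)).2⟩

namespace IsFlowBox

variable {f : ℝ → E → E} {A : ℝ → E → E →L[ℂ] E} {x₀ : E} {t₀ ρ T M K L : ℝ}

theorem lipschitz (hb : IsFlowBox f A x₀ t₀ ρ T M K L) {s : ℝ} (hs : s ∈ Icc (t₀ - T) (t₀ + T))
    {x y : E} (hx : x ∈ closedBall x₀ (2 * ρ)) (hy : y ∈ closedBall x₀ (2 * ρ)) :
    ‖f s y - f s x‖ ≤ K * ‖y - x‖ :=
  (convex_closedBall x₀ (2 * ρ)).norm_image_sub_le_of_norm_hasFDerivWithin_le (𝕜 := ℂ)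
    (fun z _ => (hb.hasFDerivAt s z).hasFDerivWithinAt) (fun z hz => hb.norm_deriv_le s hs z hz)
    hx hy

theorem taylor (hb : IsFlowBox f A x₀ t₀ ρ T M K L) {s : ℝ} (hs : s ∈ Icc (t₀ - T) (t₀ + T))
    {x y : E} (hx : x ∈ closedBall x₀ (2 * ρ)) (hy : y ∈ closedBall x₀ (2 * ρ)) :
    ‖f s y - f s x - A s x (y - x)‖ ≤ L * ‖y - x‖ ^ 2 := by
  have hseg : segment ℝ x y ⊆ closedBall x₀ (2 * ρ) :=
    (convex_closedBall x₀ (2 * ρ)).segment_subset hx hy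
  have := (convex_segment x y).norm_image_sub_le_of_norm_hasFDerivWithin_le' (𝕜 := ℂ)
    (f := f s) (f' := A s) (φ := A s x) (C := L * ‖y - x‖)
    (fun z _ => (hb.hasFDerivAt s z).hasFDerivWithinAt)
    (fun z hz => (hb.lip_deriv s hs x hx z (hseg hz)).trans
      (mul_le_mul_of_nonneg_left (norm_sub_le_of_mem_segment hz) hb.nonneg_lip))
    (left_mem_segment ℝ x y) (right_mem_segment ℝ x y)
  calc _ ≤ _ := this
    _ = _ := by ring

/-- Solutions that pass through the inner ball exist on the whole time interval of the box. -/
theorem exists_curve [CompleteSpace E] (hb : IsFlowBox f A x₀ t₀ ρ T M K L) {w : E}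
    (hw : w ∈ closedBall x₀ ρ) {t : ℝ} (ht : t ∈ Icc (t₀ - T) (t₀ + T)) :
    ∃ x : ℝ → E, x t = w ∧ IsBoxCurve f x₀ ρ (Icc (t₀ - T) (t₀ + T)) x := by
  have hsub : closedBall w ρ ⊆ closedBall x₀ (2 * ρ) := by
    refine closedBall_subset_closedBall' ?_
    have := mem_closedBall.1 hw
    linarith
  have hpl : IsPicardLindelof f (⟨t, ht⟩ : Icc (t₀ - T) (t₀ + T)) w (NNReal.mk ρ hb.pos_radius.le) 0
      (NNReal.mk M hb.nonneg_bound) (NNReal.mk K hb.nonneg_deriv) := by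
    refine ⟨fun s hs => ?_, fun x _ => ?_, fun s hs x hx => hb.norm_le s hs x (hsub hx), ?_⟩
    · refine LipschitzOnWith.of_dist_le_mul fun x hx y hy => ?_
      rw [dist_eq_norm, dist_eq_norm]
      exact hb.lipschitz hs (hsub hy) (hsub hx)
    · exact (hb.contDiff.continuous.comp (Continuous.prodMk_left x)).continuousOn
    · have h1 : max (t₀ + T - t) (t - (t₀ - T)) ≤ 2 * T :=
        max_le (by linarith [ht.1]) (by linarith [ht.2])
      calc _ ≤ M * (2 * T) := mul_le_mul_of_nonneg_left h1 hb.nonneg_bound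
        _ ≤ _ := by simpa using hb.short
  obtain ⟨α, hα⟩ := ODE.FunSpace.exists_isFixedPt_next hpl (mem_closedBall_self le_rfl)
  refine ⟨α.compProj, by
    rw [ODE.FunSpace.compProj_of_mem ht, ← hα, ODE.FunSpace.next_apply₀], fun s hs =>
    ⟨?_, hsub (α.compProj_mem_closedBall hpl.mul_max_le)⟩⟩
  refine (ODE.hasDerivWithinAt_picard_Icc (t₀ := t) ht hpl.continuousOn_uncurry
    α.continuous_compProj.continuousOn (fun _ _ => α.compProj_mem_closedBall hpl.mul_max_le)
    w hs).congr_of_mem (fun s' hs' => ?_) hs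
  nth_rw 1 [← hα]
  rw [ODE.FunSpace.compProj_of_mem hs', ODE.FunSpace.next_apply]

/-- The adjoint linear equation along a curve in the box has solutions. -/
theorem exists_momentum (hb : IsFlowBox f A x₀ t₀ ρ T M K L) {x : ℝ → E}
    (hx : IsBoxCurve f x₀ ρ (Icc (t₀ - T) (t₀ + T)) x) (P₀ : StrongDual ℂ E) :
    ∃ P : ℝ → StrongDual ℂ E, P t₀ = P₀ ∧ ∀ s ∈ Icc (t₀ - T) (t₀ + T),
      HasDerivWithinAt P (-(P s ∘L A s (x s))) (Icc (t₀ - T) (t₀ + T)) s := by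
  have ht₀ : t₀ ∈ Icc (t₀ - T) (t₀ + T) := by
    constructor <;> linarith [hb.pos_time]
  have hxc : ContinuousOn x (Icc (t₀ - T) (t₀ + T)) := fun s hs => (hx s hs).1.continuousWithinAt
  have hK := hb.nonneg_deriv
  have hP0 := norm_nonneg P₀
  have hpl : IsPicardLindelof (fun s (P : StrongDual ℂ E) => -(P ∘L A s (x s)))
      (⟨t₀, ht₀⟩ : Icc (t₀ - T) (t₀ + T)) P₀ (NNReal.mk (‖P₀‖ + 1) (by positivity)) 0
      (NNReal.mk ((2 * ‖P₀‖ + 1) * K) (by positivity)) (NNReal.mk K hK) := by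
    refine ⟨fun s hs => ?_, fun P _ => ?_, fun s hs P hP => ?_, ?_⟩
    · refine LipschitzOnWith.of_dist_le_mul fun P _ Q _ => ?_
      rw [dist_neg_neg, dist_eq_norm, dist_eq_norm, ← ContinuousLinearMap.sub_comp, mul_comm]
      exact (ContinuousLinearMap.opNorm_comp_le _ _).trans
        (mul_le_mul_of_nonneg_left (hb.norm_deriv_le s hs _ (hx s hs).2) (norm_nonneg _))
    · have h1 : ContinuousOn (fun s => A s (x s)) (Icc (t₀ - T) (t₀ + T)) :=
        hb.continuous_deriv.comp_continuousOn (continuousOn_id.prodMk hxc)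
      exact (continuousOn_const.clm_comp h1).neg
    · have h1 : ‖P‖ ≤ 2 * ‖P₀‖ + 1 := by
        have h2 : ‖P - P₀‖ ≤ ‖P₀‖ + 1 := by
          rw [← dist_eq_norm]; exact mem_closedBall.1 hP
        have h3 := norm_le_norm_add_norm_sub' P P₀
        linarith
      rw [norm_neg]
      exact (ContinuousLinearMap.opNorm_comp_le _ _).trans
        (mul_le_mul h1 (hb.norm_deriv_le s hs _ (hx s hs).2) (norm_nonneg _) (by positivity))
    · have h1 : max (t₀ + T - t₀) (t₀ - (t₀ - T)) = T := by simp
      change (2 * ‖P₀‖ + 1) * K * max (t₀ + T - t₀) (t₀ - (t₀ - T)) ≤ ‖P₀‖ + 1 - 0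
      rw [h1]
      nlinarith [hb.short_deriv]
  obtain ⟨P, hP1, hP2⟩ := hpl.exists_eq_forall_mem_Icc_hasDerivWithinAt₀
  exact ⟨P, hP1, hP2⟩

variable {t : ℝ} {x y : ℝ → E}

theorem uIcc_subset (hb : IsFlowBox f A x₀ t₀ ρ T M K L) (ht : t ∈ Icc (t₀ - T) (t₀ + T)) :
    uIcc t₀ t ⊆ Icc (t₀ - T) (t₀ + T) := by
  refine uIcc_subset_Icc ⟨?_, ?_⟩ ht <;> linarith [hb.pos_time]

theorem abs_sub_le (hb : IsFlowBox f A x₀ t₀ ρ T M K L) (ht : t ∈ Icc (t₀ - T) (t₀ + T))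
    {s s' : ℝ} (hs : s ∈ uIcc t₀ t) (hs' : s' ∈ uIcc t₀ t) : |s - s'| ≤ 2 * T := by
  have h1 := hb.uIcc_subset ht hs
  have h2 := hb.uIcc_subset ht hs'
  rw [abs_le]
  constructor <;> linarith [h1.1, h1.2, h2.1, h2.2]

/-- The distance of two curves in the box grows by a factor of two at most. In place of Gronwall's
inequality, the derivative is estimated by the largest distance. -/
theorem norm_sub_le (hb : IsFlowBox f A x₀ t₀ ρ T M K L) (ht : t ∈ Icc (t₀ - T) (t₀ + T))
    (hx : IsBoxCurve f x₀ ρ (uIcc t₀ t) x) (hy : IsBoxCurve f x₀ ρ (uIcc t₀ t) y) :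
    ∀ s ∈ uIcc t₀ t, ‖y s - x s‖ ≤ 2 * ‖y t - x t‖ := by
  have hd : ∀ s ∈ uIcc t₀ t,
      HasDerivWithinAt (fun s => y s - x s) (f s (y s) - f s (x s)) (uIcc t₀ t) s :=
    fun s hs => (hy s hs).1.sub (hx s hs).1
  obtain ⟨m, hm, hmax⟩ := isCompact_uIcc.exists_isMaxOn (nonempty_uIcc (a := t₀) (b := t))
    (f := fun s => ‖y s - x s‖) fun s hs => (hd s hs).continuousWithinAt.norm
  have h1 := (convex_uIcc t₀ t).norm_image_sub_le_of_norm_hasDerivWithin_le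
    (C := K * ‖y m - x m‖) hd (fun s hs =>
      (hb.lipschitz (hb.uIcc_subset ht hs) (hx s hs).2 (hy s hs).2).trans
        (mul_le_mul_of_nonneg_left (hmax hs) hb.nonneg_deriv)) right_mem_uIcc hm
  have h2 := hb.abs_sub_le ht hm right_mem_uIcc
  have h3 : K * ‖y m - x m‖ * ‖m - t‖ ≤ 1 / 2 * ‖y m - x m‖ := by
    calc _ ≤ K * ‖y m - x m‖ * (2 * T) :=
          mul_le_mul_of_nonneg_left h2 (mul_nonneg hb.nonneg_deriv (norm_nonneg _))
      _ = K * (2 * T) * ‖y m - x m‖ := by ring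
      _ ≤ _ := mul_le_mul_of_nonneg_right hb.short_deriv (norm_nonneg _)
  have h4 := norm_le_norm_add_norm_sub' (y m - x m) (y t - x t)
  intro s hs
  have h5 : ‖y s - x s‖ ≤ ‖y m - x m‖ := hmax hs
  linarith

/-- The pairing of a solution `P` of the adjoint equation along `x` with the difference of a
neighbouring curve `y` and `x` is constant up to an error of second order. -/
theorem norm_pairing_sub_le (hb : IsFlowBox f A x₀ t₀ ρ T M K L)
    (ht : t ∈ Icc (t₀ - T) (t₀ + T)) (hx : IsBoxCurve f x₀ ρ (uIcc t₀ t) x)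
    (hy : IsBoxCurve f x₀ ρ (uIcc t₀ t) y) {P : ℝ → StrongDual ℂ E}
    (hP : ∀ s ∈ uIcc t₀ t, HasDerivWithinAt P (-(P s ∘L A s (x s))) (uIcc t₀ t) s) {C : ℝ}
    (hC : ∀ s ∈ uIcc t₀ t, ‖P s‖ ≤ C) :
    ‖P t (y t - x t) - P t₀ (y t₀ - x t₀)‖ ≤ C * L * (2 * T) * 4 * ‖y t - x t‖ ^ 2 := by
  have hC0 : 0 ≤ C := (norm_nonneg _).trans (hC t right_mem_uIcc)
  have hd : ∀ s ∈ uIcc t₀ t, HasDerivWithinAt (fun s => P s (y s - x s))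
      (P s (f s (y s) - f s (x s) - A s (x s) (y s - x s))) (uIcc t₀ t) s := by
    intro s hs
    refine (hasDerivWithinAt_clm_apply_complex (hP s hs)
      ((hy s hs).1.sub (hx s hs).1)).congr_deriv ?_
    simp only [map_sub, neg_apply, ContinuousLinearMap.comp_apply, Pi.sub_apply]
    ring
  have hbound : ∀ s ∈ uIcc t₀ t, ‖P s (f s (y s) - f s (x s) - A s (x s) (y s - x s))‖ ≤
      C * (L * (4 * ‖y t - x t‖ ^ 2)) := by
    intro s hs
    have h1 := hb.taylor (hb.uIcc_subset ht hs) (hx s hs).2 (hy s hs).2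
    have h2 : ‖y s - x s‖ ^ 2 ≤ 4 * ‖y t - x t‖ ^ 2 := by
      have := pow_le_pow_left₀ (norm_nonneg _) (hb.norm_sub_le ht hx hy s hs) 2
      calc _ ≤ _ := this
        _ = _ := by ring
    exact (P s).le_of_opNorm_le_of_le (hC s hs)
      (h1.trans (mul_le_mul_of_nonneg_left h2 hb.nonneg_lip))
  have h1 := (convex_uIcc t₀ t).norm_image_sub_le_of_norm_hasDerivWithin_le hd hbound
    left_mem_uIcc right_mem_uIcc
  have h2 := hb.abs_sub_le ht right_mem_uIcc left_mem_uIcc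
  calc _ ≤ _ := h1
    _ ≤ C * (L * (4 * ‖y t - x t‖ ^ 2)) * (2 * T) :=
      mul_le_mul_of_nonneg_left h2 (mul_nonneg hC0 (mul_nonneg hb.nonneg_lip (by positivity)))
    _ = _ := by ring

/-- A solution that meets a curve in the box coincides with it, even if it is not assumed to stay in
the box. -/
theorem eqOn_of_eq (hb : IsFlowBox f A x₀ t₀ ρ T M K L) {W : ℝ → E}
    (hW : ∀ s ∈ uIcc t₀ t, HasDerivAt W (f s (W s)) s)
    (hx : IsBoxCurve f x₀ ρ (uIcc t₀ t) x) (h : W t = x t) : EqOn W x (uIcc t₀ t) := by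
  have hWc : ContinuousOn W (uIcc t₀ t) := fun s hs => (hW s hs).continuousAt.continuousWithinAt
  have hxc : ContinuousOn x (uIcc t₀ t) := fun s hs => (hx s hs).1.continuousWithinAt
  set D : Set E := W '' uIcc t₀ t ∪ x '' uIcc t₀ t
  have hD : IsCompact D := (isCompact_uIcc.image_of_continuousOn hWc).union
    (isCompact_uIcc.image_of_continuousOn hxc)
  obtain ⟨κ, hκ⟩ := LocallyLipschitzOn.exists_lipschitzOnWith_of_compact
    (isCompact_uIcc.prod hD) (hb.contDiff.locallyLipschitz.locallyLipschitzOn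
      (s := uIcc t₀ t ×ˢ D))
  have hlip : ∀ s ∈ uIcc t₀ t, LipschitzOnWith κ (f s) D := fun s hs =>
    LipschitzOnWith.of_dist_le_mul fun a ha b hb' => by
      have := hκ.dist_le_mul (s, a) ⟨hs, ha⟩ (s, b) ⟨hs, hb'⟩
      simpa [Prod.dist_eq] using this
  have hWD : ∀ s ∈ uIcc t₀ t, W s ∈ D := fun s hs => Or.inl ⟨s, hs, rfl⟩
  have hxD : ∀ s ∈ uIcc t₀ t, x s ∈ D := fun s hs => Or.inr ⟨s, hs, rfl⟩
  rcases le_total t₀ t with h0 | h0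
  · rw [uIcc_of_le h0] at *
    have hsub : Ioc t₀ t ⊆ Icc t₀ t := Ioc_subset_Icc_self
    exact ODE_solution_unique_of_mem_Icc_left (fun s hs => hlip s (hsub hs)) hWc
      (fun s hs => (hW s (hsub hs)).hasDerivWithinAt) (fun s hs => hWD s (hsub hs)) hxc
      (fun s hs => (hx s (hsub hs)).1.mono_of_mem_nhdsWithin (Icc_mem_nhdsLE_of_mem hs))
      (fun s hs => hxD s (hsub hs)) h
  · rw [uIcc_of_ge h0] at *
    have hsub : Ico t t₀ ⊆ Icc t t₀ := Ico_subset_Icc_self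
    exact ODE_solution_unique_of_mem_Icc_right (fun s hs => hlip s (hsub hs)) hWc
      (fun s hs => (hW s (hsub hs)).hasDerivWithinAt) (fun s hs => hWD s (hsub hs)) hxc
      (fun s hs => (hx s (hsub hs)).1.mono_of_mem_nhdsWithin (Icc_mem_nhdsGE_of_mem hs))
      (fun s hs => hxD s (hsub hs)) h

end IsFlowBox

end FlowBox

/-! ### Linearity in the conjugate field -/

section Linearity

variable {E : Type u} [NormedAddCommGroup E] [NormedSpace ℂ E] {H : Phase E → ℂ} {V : Phase E → E}

/-- If `ε` is constant, Euler's relation `Π (∂H/∂Π) - H = ε` makes `H + ε` homogeneous of degree one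
along every ray in `Π`. Since `H` is differentiable at `Π = 0`, it is affine in `Π`. -/
theorem hamiltonian_eq (hH : IsSmoothHol H) (hV : ∀ p ξ, dPi H p ξ = ξ (V p))
    (hdε : ∀ p, diff (constraint H) p = 0) (w : E) (ξ : StrongDual ℂ E) (t : ℝ) (p : Phase E) :
    H (w, ξ, t) = ξ (V (w, 0, t)) - constraint H p := by
  let γ : ℝ → Phase E := fun s => (w, s • ξ, t)
  have hγ : ∀ s, HasDerivAt γ (0, ξ, 0) s := fun s => by
    have h1 : HasDerivAt (fun s : ℝ => s • ξ) ξ s := by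
      simpa using (hasDerivAt_id s).smul_const ξ
    exact (hasDerivAt_const s w).prodMk (h1.prodMk (hasDerivAt_const s t))
  have hg : ∀ s, HasDerivAt (fun s => H (γ s)) (dPi H (γ s) ξ) s := fun s =>
    (hH.comp_hasDerivAt (hγ s)).congr_deriv (by simp [diff_apply, incl])
  have heuler : ∀ s : ℝ, H (γ s) + constraint H p = s * dPi H (γ s) ξ := fun s => by
    rw [constraint_eq hH hdε p (γ s), constraint, hV, hV]
    have : (s • ξ) (V (γ s)) = (s : ℂ) * ξ (V (γ s)) := rfl
    change H (γ s) + ((s • ξ) (V (γ s)) - H (γ s)) = _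
    rw [this]
    ring
  have hcont : Continuous fun s => dPi H (γ s) ξ :=
    (hH.dPi.smooth.continuous.comp
      (continuous_iff_continuousAt.2 fun s => (hγ s).continuousAt)).clm_apply continuous_const
  have hd : ∀ s ∈ Ioi (0 : ℝ),
      HasDerivAt (fun s : ℝ => (H (γ s) + constraint H p) / (s : ℂ)) 0 s := by
    intro s hs
    have hs0 : (s : ℂ) ≠ 0 := by exact_mod_cast (ne_of_gt hs)
    refine (((hg s).add_const (constraint H p)).div (hasDerivAt_id s).ofReal_comp hs0).congr_deriv ?_
    simp only [id, heuler s]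
    simp [mul_comm]
  have hconst : ∀ s ∈ Ioi (0 : ℝ), dPi H (γ s) ξ = H (γ 1) + constraint H p := by
    intro s hs
    have hs0 : (s : ℂ) ≠ 0 := by exact_mod_cast (ne_of_gt hs)
    have h1 := isOpen_Ioi.is_const_of_deriv_eq_zero isPreconnected_Ioi
      (fun r hr => (hd r hr).differentiableAt.differentiableWithinAt)
      (fun r hr => (hd r hr).deriv) hs (show (1 : ℝ) ∈ Ioi 0 by simp)
    simp only [heuler s, Complex.ofReal_one, div_one] at h1
    rwa [mul_div_cancel_left₀ _ hs0] at h1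
  have h0 : dPi H (γ 0) ξ = H (γ 1) + constraint H p :=
    tendsto_nhds_unique ((hcont.tendsto 0).mono_left nhdsWithin_le_nhds)
      (tendsto_const_nhds.congr' (f₁ := fun _ => H (γ 1) + constraint H p)
        (eventually_of_mem self_mem_nhdsWithin fun s hs => (hconst s hs).symm))
  have e0 : γ 0 = (w, 0, t) := by
    simp only [γ]
    rw [zero_smul ℝ ξ]
  have e1 : γ 1 = (w, ξ, t) := by
    simp only [γ]
    rw [one_smul ℝ ξ]
  rw [e0, e1, hV] at h0
  rw [h0]
  ring

/-- The velocity `∂H/∂Π` does not depend on `Π`. -/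
theorem velocity_eq (hH : IsSmoothHol H) (hV : ∀ p ξ, dPi H p ξ = ξ (V p))
    (hdε : ∀ p, diff (constraint H) p = 0) (w : E) (ξ : StrongDual ℂ E) (t : ℝ) :
    V (w, ξ, t) = V (w, 0, t) := by
  refine (NormedSpace.inclusionInDoubleDualLi (E := E) ℂ).injective ?_
  ext η
  have h1 := hH.hasFDerivAt_snd (w, ξ, t)
  have h2 : HasFDerivAt (𝕜 := ℂ) (fun ξ : StrongDual ℂ E => H (w, ξ, t))
      (ContinuousLinearMap.apply ℂ ℂ (V (w, 0, t))) ξ := by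
    rw [funext fun ξ : StrongDual ℂ E => hamiltonian_eq hH hV hdε w ξ t (w, 0, t)]
    exact (ContinuousLinearMap.apply ℂ ℂ (V (w, 0, t))).hasFDerivAt.sub_const _
  have h3 := congrArg (fun A => A η) (h1.unique h2)
  exact (hV _ η).symm.trans h3

theorem dW_hamiltonian_eq [CompleteSpace E] (hH : IsSmoothHol H)
    (hV : ∀ p ξ, dPi H p ξ = ξ (V p)) (hdε : ∀ p, diff (constraint H) p = 0) (w : E)
    (ξ : StrongDual ℂ E) (t : ℝ) : dW H (w, ξ, t) = ξ ∘L dW V (w, 0, t) := by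
  have h1 := hH.hasFDerivAt_fst (w, ξ, t)
  have h2 := (isSmoothHol_of_dPi hH hV).hasFDerivAt_fst (w, 0, t)
  refine h1.unique ?_
  rw [funext fun w' : E => hamiltonian_eq hH hV hdε w' ξ t (w, 0, t)]
  exact (ξ.hasFDerivAt.comp w h2).sub_const _

theorem contDiff_dW_of_isSmoothHol [CompleteSpace E] {V : Phase E → E} (hV : IsSmoothHol V) :
    ContDiff ℝ ∞ (dW V) := by
  refine contDiff_of_comp_isometry
    (ContinuousLinearMap.restrictScalarsIsometry ℂ E E ℝ ℝ) ?_
  have : (fun p => ContinuousLinearMap.restrictScalarsIsometry ℂ E E ℝ ℝ (dW V p)) =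
      fun p => fderiv ℝ V p ∘L ContinuousLinearMap.inl ℝ E (StrongDual ℂ E × ℝ) := by
    funext p; ext a; exact hV.dW_apply p a
  rw [this]
  exact (hV.smooth.fderiv_right (by simp)).clm_comp contDiff_const

end Linearity

/-! ### Flow boxes and foot points -/

section Box

open Metric
open scoped NNReal

variable {E : Type u} [NormedAddCommGroup E] [NormedSpace ℂ E]
variable {f : ℝ → E → E} {A : ℝ → E → E →L[ℂ] E}

/-- Flow boxes exist around every point and in every neighbourhood of it. -/
theorem exists_isFlowBox (hf : ContDiff ℝ 1 (Function.uncurry f))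
    (hA : ContDiff ℝ 1 (Function.uncurry A)) (hfA : ∀ s x, HasFDerivAt (f s) (A s x) x)
    (x₀ : E) (t₀ : ℝ) {R : ℝ} (hR : 0 < R) :
    ∃ ρ T M K L, 2 * ρ < R ∧ IsFlowBox f A x₀ t₀ ρ T M K L := by
  obtain ⟨L, O, hO, hL⟩ := (hA.contDiffAt (x := (t₀, x₀))).exists_lipschitzOnWith
  have h1 : ∀ᶠ q : ℝ × E in 𝓝 (t₀, x₀), ‖f q.1 q.2‖ < ‖f t₀ x₀‖ + 1 :=
    (hf.continuous.norm.tendsto (t₀, x₀)).eventually_lt_const (by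
      simp only [Function.uncurry_apply_pair]; linarith)
  have h2 : ∀ᶠ q : ℝ × E in 𝓝 (t₀, x₀), ‖A q.1 q.2‖ < ‖A t₀ x₀‖ + 1 :=
    (hA.continuous.norm.tendsto (t₀, x₀)).eventually_lt_const (by
      simp only [Function.uncurry_apply_pair]; linarith)
  obtain ⟨δ, hδ, hball⟩ := Metric.eventually_nhds_iff_ball.1 (h1.and (h2.and hO))
  set M := ‖f t₀ x₀‖ + 1
  set K := ‖A t₀ x₀‖ + 1
  have hM : 0 < M := by positivity
  have hK : 0 < K := by positivity
  have hmin : 0 < min δ R := lt_min hδ hR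
  set ρ := min δ R / 4 with hρdef
  have hρ : 0 < ρ := by positivity
  set T := min (δ / 2) (min (ρ / (2 * M)) (1 / (4 * K)))
  have hT1 : T ≤ δ / 2 := min_le_left _ _
  have hT2 : T ≤ ρ / (2 * M) := (min_le_right _ _).trans (min_le_left _ _)
  have hT3 : T ≤ 1 / (4 * K) := (min_le_right _ _).trans (min_le_right _ _)
  have hρδ : 2 * ρ < δ := by linarith [min_le_left δ R]
  have hmem : ∀ s ∈ Icc (t₀ - T) (t₀ + T), ∀ x ∈ closedBall x₀ (2 * ρ),
      (s, x) ∈ ball (t₀, x₀) δ := by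
    intro s hs x hx
    have h3 : dist s t₀ ≤ T := by
      rw [Real.dist_eq, abs_le]
      constructor <;> linarith [hs.1, hs.2]
    rw [mem_ball, Prod.dist_eq]
    exact max_lt (by linarith) (lt_of_le_of_lt (mem_closedBall.1 hx) hρδ)
  refine ⟨ρ, T, M, K, L, by linarith [min_le_right δ R], hρ, by positivity, hM.le, hK.le, L.2, hf,
    hA.continuous, hfA, fun s hs x hx => (hball _ (hmem s hs x hx)).1.le,
    fun s hs x hx => (hball _ (hmem s hs x hx)).2.1.le, fun s hs x hx y hy => ?_, ?_, ?_⟩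
  · have := hL.norm_sub_le (hball _ (hmem s hs y hy)).2.2 (hball _ (hmem s hs x hx)).2.2
    simpa [Prod.norm_def] using this
  · calc M * (2 * T) ≤ M * (2 * (ρ / (2 * M))) := by gcongr
      _ = ρ := by field_simp
  · calc K * (2 * T) ≤ K * (2 * (1 / (4 * K))) := by gcongr
      _ = 1 / 2 := by field_simp; norm_num

/-- The first order expansion of `S₀` along small displacements `δ`, with the linear term known up to
an error of second order. -/
theorem isLittleO_sub_of_norm_le {ι : Type*} {l : Filter ι} {S₀ : E → ℂ} {P₀ : StrongDual ℂ E}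
    {a : E} (hS : HasFDerivAt S₀ P₀ a) {y d : ι → E} {q : ι → ℂ} {C : ℝ}
    (hy : ∀ᶠ i in l, ‖y i - a‖ ≤ 2 * ‖d i‖)
    (hq : ∀ᶠ i in l, ‖q i - P₀ (y i - a)‖ ≤ C * ‖d i‖ ^ 2) (hd : Tendsto d l (𝓝 0)) :
    (fun i => S₀ (y i) - S₀ a - q i) =o[l] d := by
  have hyd : (fun i => y i - a) =O[l] d := Asymptotics.IsBigO.of_bound 2 hy
  have hya : Tendsto y l (𝓝 a) := by
    have := (hyd.trans_tendsto hd).add_const a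
    simpa using this
  have h1 : (fun i => S₀ (y i) - S₀ a - P₀ (y i - a)) =o[l] d :=
    (hS.isLittleO.comp_tendsto hya).trans_isBigO hyd
  have h2 : (fun i => q i - P₀ (y i - a)) =o[l] d := by
    have h3 : (fun i => q i - P₀ (y i - a)) =O[l] fun i => ‖d i‖ ^ 2 :=
      Asymptotics.IsBigO.of_bound C (hq.mono fun i hi => by simpa using hi)
    have h4 : (fun i => ‖d i‖ ^ 2) =o[l] fun i => ‖d i‖ := by
      have := (Asymptotics.isLittleO_pow_id (𝕜 := ℝ) (n := 2) (by norm_num)).comp_tendsto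
        (tendsto_norm_zero.comp hd)
      simpa [Function.comp_def] using this
    exact (h3.trans_isLittleO h4).of_norm_right
  exact (h1.sub h2).congr_left fun i => by ring

/-- The point at time `t₀` of the solution in the box that passes through `w` at time `t`; the value
is `w` if there is none. -/
noncomputable def footPoint (f : ℝ → E → E) (x₀ : E) (t₀ ρ T : ℝ) (w : E) (t : ℝ) : E :=
  open scoped Classical in
  if h : ∃ x : ℝ → E, x t = w ∧ IsBoxCurve f x₀ ρ (Icc (t₀ - T) (t₀ + T)) x then h.choose t₀ else w

theorem footPoint_self (f : ℝ → E → E) (x₀ : E) (t₀ ρ T : ℝ) (w : E) :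
    footPoint f x₀ t₀ ρ T w t₀ = w := by
  rw [footPoint]
  split_ifs with h
  · exact h.choose_spec.1
  · rfl


namespace IsFlowBox

variable {x₀ : E} {t₀ ρ T M K L : ℝ} {t : ℝ} {x : ℝ → E} {w : E} {S₀ : E → ℂ}
  {P : ℝ → StrongDual ℂ E}

theorem footPoint_eq [CompleteSpace E] (hb : IsFlowBox f A x₀ t₀ ρ T M K L)
    (hw : w ∈ closedBall x₀ ρ) (ht : t ∈ Icc (t₀ - T) (t₀ + T))
    (hx : IsBoxCurve f x₀ ρ (uIcc t₀ t) x) (hxw : x t = w) : footPoint f x₀ t₀ ρ T w t = x t₀ := by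
  have h := hb.exists_curve hw ht
  rw [footPoint, dif_pos h]
  obtain ⟨h1, h2⟩ := h.choose_spec
  have := hb.norm_sub_le ht hx (h2.mono (hb.uIcc_subset ht)) t₀ left_mem_uIcc
  rw [h1, hxw, sub_self, norm_zero, mul_zero] at this
  exact sub_eq_zero.1 (norm_le_zero_iff.1 this)

/-- A solution of the adjoint equation that starts with `dS₀` at the foot point arrives with the
derivative of `S₀ ∘ footPoint` in the endpoint. -/
theorem hasFDerivAt_footPoint [CompleteSpace E] (hb : IsFlowBox f A x₀ t₀ ρ T M K L)
    (hw : w ∈ ball x₀ ρ) (ht : t ∈ Icc (t₀ - T) (t₀ + T))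
    (hx : IsBoxCurve f x₀ ρ (uIcc t₀ t) x) (hxw : x t = w)
    (hP : ∀ s ∈ uIcc t₀ t, HasDerivWithinAt P (-(P s ∘L A s (x s))) (uIcc t₀ t) s)
    (hS : HasFDerivAt S₀ (P t₀) (x t₀)) :
    HasFDerivAt (𝕜 := ℂ) (fun w' => S₀ (footPoint f x₀ t₀ ρ T w' t)) (P t) w := by
  obtain ⟨C, hC⟩ := isCompact_uIcc.exists_bound_of_continuousOn fun s hs =>
    (hP s hs).continuousWithinAt
  have hex : ∀ᶠ w' in 𝓝 w, ∃ y, y t = w' ∧ footPoint f x₀ t₀ ρ T w' t = y t₀ ∧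
      IsBoxCurve f x₀ ρ (uIcc t₀ t) y := by
    filter_upwards [isOpen_ball.mem_nhds hw] with w' hw'
    obtain ⟨y, hy1, hy2⟩ := hb.exists_curve (ball_subset_closedBall hw') ht
    have hy3 := hy2.mono (hb.uIcc_subset ht)
    exact ⟨y, hy1, hb.footPoint_eq (ball_subset_closedBall hw') ht hy3 hy1, hy3⟩
  refine .of_isLittleO ?_
  rw [hb.footPoint_eq (ball_subset_closedBall hw) ht hx hxw]
  refine isLittleO_sub_of_norm_le hS (C := C * L * (2 * T) * 4) ?_ ?_ ?_
  · filter_upwards [hex] with w' ⟨y, hy1, hy2, hy3⟩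
    rw [hy2, ← hy1, ← hxw]
    exact hb.norm_sub_le ht hx hy3 t₀ left_mem_uIcc
  · filter_upwards [hex] with w' ⟨y, hy1, hy2, hy3⟩
    rw [hy2, ← hy1, ← hxw]
    exact hb.norm_pairing_sub_le ht hx hy3 hP hC
  · have : ContinuousAt (fun w' => w' - w) w := by fun_prop
    simpa [ContinuousAt] using this

/-- The transport equation `∂S/∂t = -(∂S/∂w) f` for `S = S₀ ∘ footPoint`. The solution that passes
through `w` at the time `s` is compared with `x`, which passes through `w` at the time `t` and has
moved on to `x s` at the time `s`. -/
theorem hasDerivAt_footPoint [CompleteSpace E] (hb : IsFlowBox f A x₀ t₀ ρ T M K L)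
    (hw : w ∈ closedBall x₀ ρ) (ht : t ∈ Ioo (t₀ - T) (t₀ + T))
    (hx : IsBoxCurve f x₀ ρ (Icc (t₀ - T) (t₀ + T)) x) (hxw : x t = w)
    (hP : ∀ s ∈ Icc (t₀ - T) (t₀ + T),
      HasDerivWithinAt P (-(P s ∘L A s (x s))) (Icc (t₀ - T) (t₀ + T)) s)
    (hS : HasFDerivAt S₀ (P t₀) (x t₀)) :
    HasDerivAt (fun s => S₀ (footPoint f x₀ t₀ ρ T w s)) (-P t (f t w)) t := by
  have hnhds := Icc_mem_nhds ht.1 ht.2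
  have ht' := Ioo_subset_Icc_self ht
  obtain ⟨C, hC⟩ := isCompact_Icc.exists_bound_of_continuousOn fun s hs =>
    (hP s hs).continuousWithinAt
  have hex : ∀ᶠ s in 𝓝 t, s ∈ Icc (t₀ - T) (t₀ + T) ∧ ∃ y, y s = w ∧
      footPoint f x₀ t₀ ρ T w s = y t₀ ∧ IsBoxCurve f x₀ ρ (uIcc t₀ s) y := by
    filter_upwards [hnhds] with s hs
    obtain ⟨y, hy1, hy2⟩ := hb.exists_curve hw hs
    have hy3 := hy2.mono (hb.uIcc_subset hs)
    exact ⟨hs, y, hy1, hb.footPoint_eq hw hs hy3 hy1, hy3⟩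
  have hd : HasDerivAt (fun s => w - x s) (-f t w) t := by
    have := ((hx t ht').1.hasDerivAt hnhds).const_sub w
    rwa [hxw] at this
  have hq : HasDerivAt (fun s => P s (w - x s)) (-P t (f t w)) t := by
    refine (hasDerivAt_clm_apply_complex ((hP t ht').hasDerivAt hnhds) hd).congr_deriv ?_
    rw [hxw, sub_self, map_zero, map_neg, zero_add]
  have hdt : Tendsto (fun s => w - x s) (𝓝 t) (𝓝 0) := by
    have := hd.continuousAt.tendsto
    rwa [hxw, sub_self] at this
  have hO : (fun s => w - x s) =O[𝓝 t] fun s => s - t := by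
    have := hd.isBigO_sub
    rw [hxw, sub_self] at this
    simpa using this
  have key : (fun s => S₀ (footPoint f x₀ t₀ ρ T w s) - S₀ (x t₀) - P s (w - x s)) =o[𝓝 t]
      fun s => s - t := by
    refine (isLittleO_sub_of_norm_le hS (C := C * L * (2 * T) * 4) ?_ ?_ hdt).trans_isBigO hO
    · filter_upwards [hex] with s ⟨hs, y, hy1, hy2, hy3⟩
      rw [hy2, ← hy1]
      exact hb.norm_sub_le hs (hx.mono (hb.uIcc_subset hs)) hy3 t₀ left_mem_uIcc
    · filter_upwards [hex] with s ⟨hs, y, hy1, hy2, hy3⟩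
      rw [hy2, ← hy1]
      have hsub := hb.uIcc_subset hs
      exact hb.norm_pairing_sub_le hs (hx.mono hsub) hy3
        (fun r hr => (hP r (hsub hr)).mono hsub) fun r hr => hC r (hsub hr)
  have hr : HasDerivAt (fun s => S₀ (footPoint f x₀ t₀ ρ T w s) - S₀ (x t₀) - P s (w - x s))
      0 t := by
    refine .of_isLittleO ?_
    have h0 := hb.footPoint_eq hw ht' (hx.mono (hb.uIcc_subset ht')) hxw
    simpa [h0, hxw] using key
  have := (hr.add hq).add_const (S₀ (x t₀))
  rw [zero_add] at this
  exact this.congr_of_eventuallyEq (Eventually.of_forall fun s => by simp)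

end IsFlowBox

end Box

/-! ### The Hamilton-Jacobi equation -/

section HamiltonJacobi

open Metric

variable {E : Type u} [NormedAddCommGroup E] [NormedSpace ℂ E] [CompleteSpace E]
  {H : Phase E → ℂ} {V : Phase E → E}

/-- The equations of motion decouple: a field moves along a vector field on `E`, and the conjugate
field solves the adjoint linear equation along it. -/
theorem isFlowLine_charVec_iff_of_diff_constraint_eq_zero (hH : IsSmoothHol H)
    (hV : ∀ p ξ, dPi H p ξ = ξ (V p)) (hdε : ∀ p, diff (constraint H) p = 0) {W : ℝ → E}
    {Pi : ℝ → StrongDual ℂ E} {I : Set ℝ} :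
    IsFlowLine (fun p => charVec H p (V p)) W Pi I ↔
      ∀ t ∈ I, HasDerivAt W (V (W t, 0, t)) t ∧
        HasDerivAt Pi (-(Pi t ∘L dW V (W t, 0, t))) t := by
  rw [isFlowLine_charVec_iff]
  refine forall₂_congr fun t _ => ?_
  rw [velocity_eq hH hV hdε, dW_hamiltonian_eq hH hV hdε]

/-- The action functional is `S₀ ∘ footPoint` plus the constant constraint times the elapsed time. The
radius is small enough for the flow box, and the flow box for the domain of analyticity of `S₀`. -/
theorem exists_hamiltonJacobi (hH : IsSmoothHol H) (hV : ∀ p ξ, dPi H p ξ = ξ (V p))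
    (hdε : ∀ p, diff (constraint H) p = 0) (W₀ : E) (t₀ : ℝ) {S₀ : E → ℂ}
    (hS₀ : AnalyticAt ℂ S₀ W₀) :
    ∃ r > 0, ∃ S : E → ℝ → ℂ, ∀ w ∈ ball W₀ r, S w t₀ = S₀ w ∧
      ∀ t ∈ Ioo (t₀ - r) (t₀ + r),
        (∃ W Pi, IsRay (fun p => charVec H p (V p)) S₀ t₀ w t W Pi) ∧
        (∀ W Pi, IsRay (fun p => charVec H p (V p)) S₀ t₀ w t W Pi →
          S w t = S₀ (W t₀) + action H t₀ t W Pi ∧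
          HasFDerivAt (𝕜 := ℂ) (fun w' => S w' t) (Pi t) w) ∧
        DifferentiableAt ℝ (fun s => S w s) t ∧
        deriv (fun s => S w s) t + H (w, fderiv ℂ (fun w' => S w' t) w, t) = 0 := by
  have hVs := isSmoothHol_of_dPi hH hV
  let f : ℝ → E → E := fun s x => V (x, 0, s)
  let A : ℝ → E → E →L[ℂ] E := fun s x => dW V (x, 0, s)
  have hpt : ContDiff ℝ ∞ fun q : ℝ × E => ((q.2, 0, q.1) : Phase E) :=
    contDiff_snd.prodMk (contDiff_const.prodMk contDiff_fst)
  have hf : ContDiff ℝ 1 (Function.uncurry f) := (hVs.smooth.comp hpt).of_le (by simp)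
  have hA : ContDiff ℝ 1 (Function.uncurry A) :=
    ((contDiff_dW_of_isSmoothHol hVs).comp hpt).of_le (by simp)
  have hfA : ∀ s x, HasFDerivAt (f s) (A s x) x := fun s x => hVs.hasFDerivAt_fst (x, 0, s)
  obtain ⟨R, hR, hSR⟩ := Metric.eventually_nhds_iff_ball.1 hS₀.eventually_analyticAt
  obtain ⟨ρ, T, M, K, L, hρR, hb⟩ := exists_isFlowBox hf hA hfA W₀ t₀ hR
  have hSd : ∀ y ∈ closedBall W₀ (2 * ρ), HasFDerivAt S₀ (fderiv ℂ S₀ y) y := fun y hy =>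
    (hSR y (closedBall_subset_ball hρR hy)).differentiableAt.hasFDerivAt
  set c := constraint H (W₀, 0, t₀)
  have hρ := hb.pos_radius
  have hT := hb.pos_time
  refine ⟨min ρ T, lt_min hρ hT, fun w t => S₀ (footPoint f W₀ t₀ ρ T w t) + c * (t - t₀ : ℝ),
    fun w hw => ⟨by simp [footPoint_self], fun t ht => ?_⟩⟩
  have hw' : w ∈ ball W₀ ρ := ball_subset_ball (min_le_left _ _) hw
  have hw'' : w ∈ closedBall W₀ ρ := ball_subset_closedBall hw'
  have ht' : t ∈ Ioo (t₀ - T) (t₀ + T) :=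
    Ioo_subset_Ioo (by linarith [min_le_right ρ T]) (by linarith [min_le_right ρ T]) ht
  have ht'' := Ioo_subset_Icc_self ht'
  have hsub : uIcc t₀ t ⊆ Icc (t₀ - T) (t₀ + T) := hb.uIcc_subset ht''
  have hsub' : uIcc t₀ t ⊆ Ioo (t₀ - T) (t₀ + T) :=
    ordConnected_Ioo.uIcc_subset ⟨by linarith, by linarith⟩ ht'
  obtain ⟨x, hxw, hx⟩ := hb.exists_curve hw'' ht''
  obtain ⟨P, hP₀, hP⟩ := hb.exists_momentum hx (fderiv ℂ S₀ (x t₀))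
  have hray : IsRay (fun p => charVec H p (V p)) S₀ t₀ w t x P := by
    refine ⟨(isFlowLine_charVec_iff_of_diff_constraint_eq_zero hH hV hdε).2 fun s hs => ?_, hP₀,
      hxw⟩
    have hn := Icc_mem_nhds (hsub' hs).1 (hsub' hs).2
    exact ⟨(hx s (hsub hs)).1.hasDerivAt hn, (hP s (hsub hs)).hasDerivAt hn⟩
  have hrays : ∀ W Pi, IsRay (fun p => charVec H p (V p)) S₀ t₀ w t W Pi →
      S₀ (footPoint f W₀ t₀ ρ T w t) + c * (t - t₀ : ℝ) = S₀ (W t₀) + action H t₀ t W Pi ∧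
      HasFDerivAt (𝕜 := ℂ) (fun w' => S₀ (footPoint f W₀ t₀ ρ T w' t) + c * (t - t₀ : ℝ))
        (Pi t) w := by
    intro W Pi h
    have hflow := (isFlowLine_charVec_iff_of_diff_constraint_eq_zero hH hV hdε).1 h.flow
    have hWx : EqOn W x (uIcc t₀ t) :=
      hb.eqOn_of_eq (fun s hs => (hflow s hs).1) (hx.mono hsub) (h.arrive.trans hxw.symm)
    have hW : IsBoxCurve f W₀ ρ (uIcc t₀ t) W := fun s hs =>
      ⟨(hflow s hs).1.hasDerivWithinAt, hWx hs ▸ (hx s (hsub hs)).2⟩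
    constructor
    · rw [hb.footPoint_eq hw'' ht'' hW h.arrive, h.flow.action_eq_integral_constraint hV,
        intervalIntegral.integral_congr fun s _ => constraint_eq hH hdε (W s, Pi s, s) (W₀, 0, t₀),
        intervalIntegral.integral_const, Complex.real_smul, mul_comm]
    · refine (hb.hasFDerivAt_footPoint hw' ht'' hW h.arrive
        (fun s hs => (hflow s hs).2.hasDerivWithinAt) ?_).add_const _
      rw [h.start]
      exact hSd _ (hW t₀ left_mem_uIcc).2
  have hder : HasDerivAt (fun s => S₀ (footPoint f W₀ t₀ ρ T w s) + c * (s - t₀ : ℝ))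
      (-P t (f t w) + c) t := by
    refine (hb.hasDerivAt_footPoint hw'' ht' hx hxw hP ?_).add ?_
    · rw [hP₀]
      exact hSd _ (hx t₀ (hsub left_mem_uIcc)).2
    · simpa using (((hasDerivAt_id t).sub_const t₀).ofReal_comp).const_mul c
  refine ⟨⟨x, P, hray⟩, hrays, hder.differentiableAt, ?_⟩
  rw [hder.deriv, (hrays x P hray).2.fderiv, hamiltonian_eq hH hV hdε w (P t) t (W₀, 0, t₀)]
  ring

end HamiltonJacobi

end LeastConstraint

theorem theorem2 {E : Type*} [NormedAddCommGroup E] [NormedSpace ℂ E] [CompleteSpace E]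
    [MeasurableSpace E] [BorelSpace E]
    -- the reference volume on the space of fields; `ℙ` contains a positive density
    (vol : Measure E) (hvol : ∃ P : ProbabilityFunctional vol, ∀ W, 0 < P.density W)
    -- the contact potential; `∂H/∂Π` is a field
    (H : Phase E → ℂ) (hH : IsSmoothHol H)
    (hvel : ∀ p, ∃ v : E, ∀ ξ : StrongDual ℂ E, dPi H p ξ = ξ v)
    -- `dε = 0` and `ε ≠ 0`
    (hdε : ∀ p, diff (constraint H) p = 0) (hε : ∀ p, constraint H p ≠ 0) :
    -- (1) on the jet bundle, `Θ = H dt - (∑ B P_μ)_j dW^j`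
    ((∀ (B : JetCoefficients E) (j : StochasticJet vol) (Pi : StrongDual ℂ E) (t : ℝ),
        IsConjugateField B j Pi → ∀ (w : E) (ξ : StrongDual ℂ E) (τ : ℂ),
          HasSum (fun k => B k j.base (j.coeff (k + 1)) w)
            (H (j.base, Pi, t) * τ - contactForm H (j.base, Pi, t) (w, ξ, τ))) ∧
      -- jets and suitable coefficients produce every point `(W, Π)` of `T*E`
      (∃ B : JetCoefficients E, ∀ (W : E) (Pi : StrongDual ℂ E),
        ∃ j : StochasticJet vol, j.base = W ∧ IsConjugateField B j Pi) ∧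
      -- `Θ` is a contact form on `T*E × ℝ`
      IsContactForm (contactForm H) ∧
      -- the rank of `dΘ` on `ker Θ`
      (∀ p, (transverseForm (contactForm H) p).rank = Module.rank ℂ (E × StrongDual ℂ E)) ∧
      -- `Θ ∧ (dΘ)^k` vanishes nowhere as long as `k` is at most half that rank, and it has top
      -- degree if `k` is equal to half that rank
      (∀ p, ∀ k : ℕ, ((2 * k : ℕ) : Cardinal) ≤ (transverseForm (contactForm H) p).rank →
        ∃ v, contactVolume (contactForm H) k p v ≠ 0) ∧
      (∀ p, ∀ n : ℕ, (transverseForm (contactForm H) p).rank = ((2 * n : ℕ) : Cardinal) →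
        Module.rank ℂ (Tangent E) = ((2 * n + 1 : ℕ) : Cardinal))) ∧
    -- (2) the characteristic vector field
    ∃ X : Phase E → Tangent E,
      (IsSmoothHol X ∧ IsCharacteristic H X ∧
        (∀ Y : Phase E → Tangent E, IsCharacteristic H Y → Y = X) ∧
        (∀ p, (∀ ξ, ξ (X p).1 = dPi H p ξ) ∧ (X p).2.1 = -dW H p ∧ (X p).2.2 = 1) ∧
        (∀ p, constraint H p = p.2.1 (X p).1 - H p) ∧
        (∀ p Y, lieD X (contactForm H) p Y = 0) ∧
        (∀ (U : Set (Phase E)) (δ : ℝ) (φ : ℝ → Phase E → Phase E), IsLocalFlow X U δ φ →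
          ∀ s ∈ Ioo (-δ) δ, ∀ p ∈ U, ∀ Y : Phase E,
            contactForm H (φ s p) (incl (fderiv ℝ (φ s) p Y)) = contactForm H p (incl Y))) ∧
      -- (3a) the action is `∫ ε dt`, and its extremals are the flow lines
      (∀ (a b : ℝ) (W : ℝ → E) (Pi : ℝ → StrongDual ℂ E), a < b →
        ContDiff ℝ 1 W → ContDiff ℝ 1 Pi →
          action H a b W Pi = ∫ t in a..b, (Pi t (deriv W t) - H (W t, Pi t, t)) ∧
          (IsExtremal H a b W Pi ↔ IsFlowLine X W Pi (Icc a b)) ∧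
          (IsExtremal H a b W Pi →
            action H a b W Pi = ∫ t in a..b, constraint H (W t, Pi t, t)) ∧
          -- (3b) the dynamical equations along extremals
          (IsExtremal H a b W Pi → ∀ t ∈ Icc a b,
            (∀ ℓ : StrongDual ℂ E, HasDerivAt (fun s => ℓ (W s))
              (bracket (fun p => ℓ p.1) H (W t, Pi t, t)) t) ∧
            (∀ v : E, HasDerivAt (fun s => Pi s v)
              (bracket (fun p => p.2.1 v) H (W t, Pi t, t)) t) ∧
            (∀ F : Phase E → ℂ, IsSmoothHol F → HasDerivAt (fun s => F (W s, Pi s, s))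
              (bracket F H (W t, Pi t, t) + dTime F (W t, Pi t, t)) t))) ∧
      (∀ p, dTime (constraint H) p = -bracket (constraint H) H p) ∧
      -- (3c) the contact Hamilton-Jacobi equation for the action as a functional of its endpoint
      (∀ (W₀ : E) (t₀ : ℝ) (S₀ : E → ℂ), AnalyticAt ℂ S₀ W₀ →
        ∃ r > 0, ∃ S : E → ℝ → ℂ, ∀ w ∈ Metric.ball W₀ r, S w t₀ = S₀ w ∧
          ∀ t ∈ Ioo (t₀ - r) (t₀ + r),
            (∃ W Pi, IsRay X S₀ t₀ w t W Pi) ∧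
            (∀ W Pi, IsRay X S₀ t₀ w t W Pi →
              S w t = S₀ (W t₀) + action H t₀ t W Pi ∧
              HasFDerivAt (𝕜 := ℂ) (fun w' => S w' t) (Pi t) w) ∧
            DifferentiableAt ℝ (fun s => S w s) t ∧
            deriv (fun s => S w s) t + H (w, fderiv ℂ (fun w' => S w' t) w, t) = 0) := by
  choose V hV' using hvel
  have hV : ∀ p ξ, dPi H p ξ = ξ (V p) := hV'
  have hVs := isSmoothHol_of_dPi hH hV
  have hX := isSmoothHol_charVec hH hV
  have hc := isCharacteristic_charVec hH hV
  have hlie := hc.lieD_eq_zero hH hdε hX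
  refine ⟨⟨fun B j Pi t h w ξ τ => hasSum_conjugateField h H t (w, ξ, τ),
    ⟨firstOrderCoefficients, fun W Pi => exists_jet hvol W Pi⟩,
    fun p => ⟨contactForm_ne_zero (hV p) (hε p), transverseForm_nondegenerate hH (hV p) (hε p)⟩,
    fun p => rank_transverseForm hH (hV p) (hε p),
    fun p k hk => exists_contactVolume_ne_zero hH (hV p) (hε p) hk,
    fun p n hn => rank_tangent ((rank_transverseForm hH (hV p) (hε p)).symm.trans hn)⟩,
    fun p => charVec H p (V p),
    ⟨hX, hc, fun Y hY => hY.eq_charVec hH hV hε,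
      fun p => ⟨fun ξ => (hV p ξ).symm, rfl, rfl⟩,
      fun p => by simp [constraint, hV, charVec], hlie,
      fun U δ φ hφ s hs p hp Y =>
        hφ.pullback_eq hX (isSmoothHol_contactForm hH) hlie hs hp Y⟩,
    ?_, ?_, fun W₀ t₀ S₀ hS₀ => exists_hamiltonJacobi hH hV hdε W₀ t₀ hS₀⟩
  · intro a b W Pi hab hW hPi
    have hiff : IsExtremal H a b W Pi ↔ IsFlowLine (fun p => charVec H p (V p)) W Pi (Icc a b) :=
      ⟨fun h => h.isFlowLine hH hV hVs.smooth.continuous hab hW hPi,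
        fun h => h.isExtremal hH hV hab hW hPi⟩
    refine ⟨action_eq H a b W Pi, hiff, fun h => ?_, fun h t ht => ?_⟩
    · refine IsFlowLine.action_eq_integral_constraint hV ?_
      rw [uIcc_of_le hab.le]
      exact hiff.1 h
    · have hflow := hiff.1 h
      have hd := isFlowLine_charVec_iff.1 hflow t ht
      refine ⟨fun ℓ => ?_, fun v => ?_, fun F hF => hflow.hasDerivAt_comp hV ht hF⟩
      · rw [bracket_field hV]
        exact (ℓ.restrictScalars ℝ).hasFDerivAt.comp_hasDerivAt t hd.1
      · rw [bracket_momentum]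
        exact ((ContinuousLinearMap.apply ℂ ℂ v).restrictScalars ℝ).hasFDerivAt.comp_hasDerivAt t hd.2
  · intro p
    obtain ⟨h1, h2, h3⟩ := partial_eq_zero_of_diff_eq_zero (hdε p)
    simp [bracket, h1, h2, h3]
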